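/- **Smoothed analysis model.** Let $G=\{(\omega_i,0,\Sigma^{(i)})\}_{i\in[k]}$ be a mixture of $k$ zero-mean Gaussians in $\mathbb R^n$ ($\omega_i\ge 0$, $\sum_i\omega_i=1$, $\Sigma^{(i)}$ symmetric) with $0\preceq\Sigma^{(i)}\preceq\frac12 I_n$, and let $0<\rho<1/n$. Let $\Delta_1,\dots,\Delta_k$ be random symmetric $n\times n$ matrices with zero diagonal whose strictly upper triangular entries are all independent $\mathcal N(0,\rho^2)$ variables. A $\rho$-smooth zero-mean mixture obtained from $G$ is any mixture $\widetilde G=\{(\widetilde\omega_i,0,\widetilde\Sigma^{(i)})\}_{i\in[k]}$ such that $\widetilde\omega_i=\omega_i$, the off-diagonal entries of $\widetilde\Sigma^{(i)}$ are those of $\Sigma^{(i)}+\Delta_i$, and the diagonal entries of $\widetilde\Sigma^{(i)}$ are chosen arbitrarily, possibly depending on the $\Delta_i$, subject to being at most $1$ and making $\widetilde\Sigma^{(i)}$ positive semidefinite; the procedure fails if no such choice exists. Let $\widetilde M_4$, $[\widetilde M_4]_{j_1j_2j_3j_4}=\mathbb E[x_{j_1}x_{j_2}x_{j_3}x_{j_4}]$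 for $x\sim\widetilde G$, be the fourth-order moment tensor. **Lemma.** There are absolute constants $C_0,C_1,C_2,C_3>0$ such that the following holds. Suppose that $n\ge C_0k^2$, that $\omega_i\ge\omega_o>0$ for all $i\in[k]$, and that $\mathcal H\subset[n]$ with $|\mathcal H|=\sqrt n$ is partitioned into three sets $\mathcal H^{(1)},\mathcal H^{(2)},\mathcal H^{(3)}$ of equal size $\sqrt n/3$. Let $\widetilde Q_S\in\mathbb R^{n\times(|\mathcal H|/3)^3}$ be the matrix whose columns are the one-dimensional slices $\widetilde M_4(e_{j_1},e_{j_2},e_{j_3},I)$, $(j_1,j_2,j_3)\in\mathcal H^{(1)}\times\mathcal H^{(2)}\times\mathcal H^{(3)}$. Then for every $\epsilon>0$ there is a measurable event in the random variables $\Delta_1,\dots,\Delta_k$ that has probability at least $1-(C_1\epsilon)^{C_2n}$, both unconditionally and conditionally on the procedure not failing, and on which, for every admissible choice of the diagonals, the $(k|\mathcal H|)$-th largest singular value satisfies $$\sigma_{k|\mathcal H|}(\widetilde Q_S)\ \ge\ C_3\,\omega_o\,\epsilon^2\rho^2 n ,$$ and the columns of $\widetilde Q_S$ span exactly $\mathcal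 S=\operatorname{span}\{\widetilde\Sigma^{(i)}_{[:,j]}: i\in[k],\ j\in\mathcal H\}$. -/

import Mathlib

open MeasureTheory ProbabilityTheory

/-- The parameters of a mixture of `k` zero-mean Gaussians in dimension `n`. -/
structure ZeroMeanMixture (n k : ℕ) where
  weight : Fin k → ℝ
  cov : Fin k → Matrix (Fin n) (Fin n) ℝ
  weight_nonneg : ∀ i, 0 ≤ weight i
  weight_sum : ∑ i, weight i = 1
  cov_posSemidef : ∀ i, (cov i).PosSemidef

namespace ZeroMeanMixture

variable {n k : ℕ}

/-- The distribution `∑ i, ω_i N(0, Σ_i)` of a sample. -/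
noncomputable def law (G : ZeroMeanMixture n k) : Measure (EuclideanSpace ℝ (Fin n)) :=
  ∑ i, ENNReal.ofReal (G.weight i) • multivariateGaussian 0 (G.cov i)

/-- The fourth-order moment tensor, `[M₄]_{j₁ j₂ j₃ j₄} = E[x_{j₁} x_{j₂} x_{j₃} x_{j₄}]`. -/
noncomputable def fourthMoment (G : ZeroMeanMixture n k) (j₁ j₂ j₃ j₄ : Fin n) : ℝ :=
  ∫ x, x j₁ * x j₂ * x j₃ * x j₄ ∂G.law

/-- The matrix whose columns, indexed by `(j₁, j₂, j₃) ∈ H₁ × H₂ × H₃`, are the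
one-dimensional slices `M₄(e_{j₁}, e_{j₂}, e_{j₃}, I)` of the fourth-order moment. -/
noncomputable def sliceMatrix (G : ZeroMeanMixture n k) (H₁ H₂ H₃ : Finset (Fin n)) :
    Matrix (Fin n) (H₁ × H₂ × H₃) ℝ :=
  Matrix.of fun r j => G.fourthMoment j.1 j.2.1 j.2.2 r

/-- The span of the covariance columns `Σ_i[:, j]`, over all components `i` and all `j ∈ H`. -/
def columnSpan (G : ZeroMeanMixture n k) (H : Finset (Fin n)) : Submodule ℝ (Fin n → ℝ) :=
  Submodule.span ℝ {v | ∃ i : Fin k, ∃ j ∈ H, v = fun r => G.cov i r j}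

end ZeroMeanMixture

/-- The values of the strictly upper triangular entries of `k` symmetric `n × n` matrices. -/
abbrev UpperEntries (n k : ℕ) : Type :=
  Fin k → {p : Fin n × Fin n // p.1 < p.2} → ℝ

/-- All strictly upper triangular entries are independent and distributed as `N(0, ρ²)`. -/
noncomputable def perturbationLaw (n k : ℕ) (ρ : ℝ) : Measure (UpperEntries n k) :=
  Measure.pi fun _ => Measure.pi fun _ => gaussianReal 0 (Real.toNNReal (ρ ^ 2))

/-- The symmetric matrix `Δ_i` with zero diagonal and the given strictly upper triangle. -/
def perturbation {n k : ℕ} (g : UpperEntries n k) (i : Fin k) : Matrix (Fin n) (Fin n) ℝ :=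
  Matrix.of fun a b =>
    if h : a < b then g i ⟨(a, b), h⟩ else if h : b < a then g i ⟨(b, a), h⟩ else 0

/-- `G'` is a possible outcome of the smoothing procedure started from `G` when the random
perturbation is `g`: the weights are kept, the off-diagonal covariance entries are those of
`Σ_i + Δ_i`, and the diagonal entries are arbitrary numbers that are at most `1` and make the
covariances positive semidefinite (which is part of `G'` being a mixture). -/
structure IsSmoothedOutcome {n k : ℕ} (G : ZeroMeanMixture n k) (g : UpperEntries n k)
    (G' : ZeroMeanMixture n k) : Prop where
  weight_eq : G'.weight = G.weight
  offDiag : ∀ i a b, a ≠ b → G'.cov i a b = (G.cov i + perturbation g i) a b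
  diag_le : ∀ i a, G'.cov i a a ≤ 1

/-- The perturbations for which the smoothing procedure does not fail. -/
def smoothingSucceeds {n k : ℕ} (G : ZeroMeanMixture n k) : Set (UpperEntries n k) :=
  {g | ∃ G', IsSmoothedOutcome G g G'}

/-- The `r`-th largest singular value of a matrix, counted with multiplicity from `r = 1`. -/
noncomputable def matrixSingularValue {m : Type*} {l : Type*} [Fintype m] [Fintype l]
    [DecidableEq l] (A : Matrix m l ℝ) (r : ℕ) : ℝ :=
  (Matrix.toEuclideanLin A).singularValues (r - 1)

/-!
Let `x_i` be the perturbed covariances, `h = |H|`, `m = h / 3`, and `n = h²`. By the formula for the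
fourth moments of a Gaussian, obtained by polarization (`ZeroMeanMixture.fourthMoment_eq`), the slice
matrix factors as `P D Tᵀ`: `P` has the columns `x_i[:, j]`, `j ∈ H`, the diagonal matrix `D` has the
weights, and `T` (`tensorMap`) sends `v` to the tensor with entries
`∑_i (v_{ip} x_i[q, r] + v_{iq} x_i[p, r] + v_{ir} x_i[p, q])`, for `p, q, r` in the three parts of
`H`. If `P` and `T` expand by factors `α` and `β`, then `P D Tᵀ` expands the range of `T`, of
dimension `k h`, by `α ω₀ β`, which bounds its `k h`-th singular value, and `Tᵀ` is onto, which gives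
the span. The map `T` sees only off-diagonal entries, and so does `P` when restricted to the rows
outside `H`, which is enough for `α`; hence the choice of the diagonals plays no role.

Each of these maps is a fixed linear map `M`, of arbitrary size compared to `ρ`, plus a Gaussian one
`Γ`, and the bound for its least singular value comes from a net argument
(`exists_event_le_norm_add_apply`).

* A Gaussian vector of `N` coordinates with arbitrary mean and covariance at least `s² I` has norm at
  most `ε s √N` with probability at most `(2 ε) ^ N` (`measureReal_sum_sq_le_le`). For `P` this
  applies to every fixed vector directly. For `T` the covariance may be degenerate, but `T v` small
  forces one of its slices with a fixed index `j ∈ H` to be small in proportion to `v_{·j}`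
  (`exists_slice_le`), and the `m²` entries of that slice are nondegenerate.
* The operator norm of `Γ` is at most a multiple of `ρ √N / ε` up to a similar probability.
* When `‖Γ‖ ≤ κ`, only vectors with `‖M v‖ ≤ 2 κ ‖v‖` can be contracted too much. These are covered by
  a net of the unit ball of the graph of `M / (2 κ)`, whose cardinality does not depend on `M`
  (`exists_net_of_norm_apply_le`). The dimension `k h` being at most `m² / 4`, the cardinality
  `(C / ε²) ^ (k h)` is absorbed by `(2 ε) ^ (m²)` (`failure_probability_le`).

Finally `Σ_i + Δ_i + I / 2` is admissible as soon as all `Δ_i` have operator norm at most `1 / 2`, so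
the procedure succeeds with probability at least `1 / 2`, and conditioning on success at most doubles
the failure probability.
-/

open scoped NNReal ENNReal

/-! ### Small balls and upper tails of Gaussian vectors -/


lemma integral_exp_mul_sq_gaussianReal {b : ℝ} (hb : b < 1 / 2) :
    ∫ x, Real.exp (b * x ^ 2) ∂(gaussianReal 0 1) = (√(1 - 2 * b))⁻¹ := by
  have h1 : 0 < 1 - 2 * b := by linarith
  rw [integral_gaussianReal_eq_integral_smul one_ne_zero]
  have : ∀ x : ℝ, gaussianPDFReal 0 1 x • Real.exp (b * x ^ 2) =
      (√(2 * Real.pi))⁻¹ * Real.exp (-(1 / 2 - b) * x ^ 2) := by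
    intro x
    simp only [gaussianPDFReal, smul_eq_mul, NNReal.coe_one, mul_one, sub_zero]
    rw [mul_assoc, ← Real.exp_add]
    ring_nf
  simp_rw [this]
  rw [integral_const_mul, integral_gaussian, ← Real.sqrt_inv, ← Real.sqrt_mul (by positivity),
    ← Real.sqrt_inv]
  congr 1
  have : (1 / 2 - b) ≠ 0 := by linarith
  field_simp

/-- Integrability comes from the value of the integral: a function that is not integrable would have
integral zero. -/
lemma integrable_exp_mul_sq_gaussianReal {b : ℝ} (hb : b < 1 / 2) :
    Integrable (fun x => Real.exp (b * x ^ 2)) (gaussianReal 0 1) := by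
  have h1 : 0 < 1 - 2 * b := by linarith
  by_contra h
  have := integral_exp_mul_sq_gaussianReal hb
  rw [integral_undef h] at this
  have : 0 < (√(1 - 2 * b))⁻¹ := by positivity
  linarith

section GaussianVector

variable {Ω C : Type*} [MeasurableSpace Ω] [Fintype C] {μ : Measure Ω} [IsProbabilityMeasure μ]
  {f : C → Ω → ℝ} {s : ℝ}

/-- If every marginal `∑ ξ_c f_c` is Gaussian with variance at least `s² |ξ|²`, whatever its mean,
then the Laplace transform of `∑ f_c²` is at most that of the squared norm of a centred Gaussian
vector with covariance `s² I`. The square is linearized by averaging `exp (i a ⟨ξ, f⟩)` over an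
independent standard Gaussian `ξ`; the means only contribute phases. -/
lemma integral_exp_neg_sum_sq_le (hf : ∀ c, Measurable (f c)) (a : ℝ)
    (hlaw : ∀ ξ : C → ℝ, ∃ (m : ℝ) (v : ℝ≥0),
      μ.map (fun ω => ∑ c, ξ c * f c ω) = gaussianReal m v ∧ s ^ 2 * ∑ c, ξ c ^ 2 ≤ v) :
    ∫ ω, Real.exp (-(a ^ 2 / 2) * ∑ c, f c ω ^ 2) ∂μ ≤
      ((√(1 + a ^ 2 * s ^ 2))⁻¹) ^ Fintype.card C := by
  let γ : Measure (C → ℝ) := Measure.pi fun _ => gaussianReal 0 1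
  let F : (C → ℝ) → Ω → ℂ := fun ξ ω =>
    Complex.exp ((a : ℂ) * (∑ c, ξ c * f c ω : ℝ) * Complex.I)
  have hFnorm : ∀ ξ ω, ‖F ξ ω‖ = 1 := by
    intro ξ ω
    simp only [F]
    rw [← Complex.ofReal_mul, Complex.norm_exp_ofReal_mul_I]
  have hFmeas : Measurable (Function.uncurry F) := by
    simp only [F, Function.uncurry_def]
    refine Complex.measurable_exp.comp (Measurable.mul_const (Measurable.const_mul
      (Complex.measurable_ofReal.comp (Finset.measurable_sum _ fun c _ => ?_)) _) _)
    exact ((measurable_pi_apply c).comp measurable_fst).mul ((hf c).comp measurable_snd)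
  have hFint : Integrable (Function.uncurry F) (γ.prod μ) := by
    refine Integrable.of_bound hFmeas.aestronglyMeasurable 1 (ae_of_all _ fun p => ?_)
    exact (hFnorm p.1 p.2).le
  have hinner : ∀ ω, ∫ ξ, F ξ ω ∂γ = (Real.exp (-(a ^ 2 / 2) * ∑ c, f c ω ^ 2) : ℂ) := by
    intro ω
    have h1 : ∀ ξ : C → ℝ, F ξ ω = ∏ c, Complex.exp (((a * f c ω : ℝ) : ℂ) * (ξ c) * Complex.I) := by
      intro ξ
      rw [← Complex.exp_sum]
      simp only [F]
      congr 1
      push_cast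
      rw [Finset.mul_sum, Finset.sum_mul]
      exact Finset.sum_congr rfl fun c _ => by ring
    simp_rw [h1]
    rw [integral_fintype_prod_eq_prod
      (f := fun c x => Complex.exp (((a * f c ω : ℝ) : ℂ) * (x : ℝ) * Complex.I))]
    simp_rw [← charFun_apply_real, charFun_gaussianReal]
    rw [← Complex.exp_sum, Complex.ofReal_exp]
    congr 1
    push_cast
    rw [Finset.mul_sum]
    exact Finset.sum_congr rfl fun c _ => by ring
  have houter : ∀ ξ, ‖∫ ω, F ξ ω ∂μ‖ ≤ ∏ c, Real.exp (-(a ^ 2 * s ^ 2 / 2) * ξ c ^ 2) := by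
    intro ξ
    obtain ⟨m, v, hmap, hv⟩ := hlaw ξ
    have hmeas : Measurable fun ω => ∑ c, ξ c * f c ω :=
      Finset.measurable_sum _ fun c _ => (hf c).const_mul _
    have h2 : ∫ ω, F ξ ω ∂μ = charFun (gaussianReal m v) a := by
      rw [← hmap, charFun_apply_real, integral_map hmeas.aemeasurable]
      exact (Measurable.aestronglyMeasurable (by fun_prop))
    rw [h2, charFun_gaussianReal, Complex.norm_exp, ← Real.exp_sum]
    apply Real.exp_le_exp.mpr
    have : ((a : ℂ) * (m : ℂ) * Complex.I - (v : ℂ) * (a : ℂ) ^ 2 / 2).re = -(v * a ^ 2 / 2) := by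
      have e : ((a : ℂ) * (m : ℂ) * Complex.I - (v : ℂ) * (a : ℂ) ^ 2 / 2) =
        ((a * m : ℝ) : ℂ) * Complex.I - ((v * a ^ 2 / 2 : ℝ) : ℂ) := by push_cast; ring
      rw [e, Complex.sub_re, Complex.re_ofReal_mul, Complex.I_re, Complex.ofReal_re]
      ring
    rw [this, ← Finset.mul_sum]
    nlinarith [sq_nonneg a]
  have hswap : ∫ ω, (∫ ξ, F ξ ω ∂γ) ∂μ = ∫ ξ, (∫ ω, F ξ ω ∂μ) ∂γ :=
    (integral_integral_swap hFint).symm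
  simp_rw [hinner] at hswap
  have hre : ∫ ω, Real.exp (-(a ^ 2 / 2) * ∑ c, f c ω ^ 2) ∂μ =
      ‖∫ ω, (Real.exp (-(a ^ 2 / 2) * ∑ c, f c ω ^ 2) : ℂ) ∂μ‖ := by
    rw [integral_complex_ofReal, Complex.norm_real, Real.norm_of_nonneg]
    exact integral_nonneg fun ω => (Real.exp_pos _).le
  have hb : -(a ^ 2 * s ^ 2 / 2) < 1 / 2 := by
    have := mul_nonneg (sq_nonneg a) (sq_nonneg s)
    linarith
  rw [hre, hswap]
  calc ‖∫ ξ, (∫ ω, F ξ ω ∂μ) ∂γ‖ ≤ ∫ ξ, ∏ c, Real.exp (-(a ^ 2 * s ^ 2 / 2) * ξ c ^ 2) ∂γ := by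
        refine norm_integral_le_of_norm_le ?_ (ae_of_all _ houter)
        exact Integrable.fintype_prod (f := fun (_ : C) x => Real.exp (-(a ^ 2 * s ^ 2 / 2) * x ^ 2))
          fun c => integrable_exp_mul_sq_gaussianReal hb
    _ = _ := by
        rw [integral_fintype_prod_eq_pow fun x => Real.exp (-(a ^ 2 * s ^ 2 / 2) * x ^ 2),
          integral_exp_mul_sq_gaussianReal hb]
        congr 4
        ring

/-- Small ball bound for a Gaussian vector with arbitrary mean and covariance at least `s² I`. -/
lemma measureReal_sum_sq_le_le (hf : ∀ c, Measurable (f c)) (hs : 0 < s) {ε : ℝ} (hε : 0 < ε)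
    (hlaw : ∀ ξ : C → ℝ, ∃ (m : ℝ) (v : ℝ≥0),
      μ.map (fun ω => ∑ c, ξ c * f c ω) = gaussianReal m v ∧ s ^ 2 * ∑ c, ξ c ^ 2 ≤ v) :
    μ.real {ω | ∑ c, f c ω ^ 2 ≤ ε ^ 2 * s ^ 2 * Fintype.card C} ≤ (2 * ε) ^ Fintype.card C := by
  set N := Fintype.card C with hN
  -- Chernoff with the Laplace parameter `a² / 2` for which the threshold contributes `exp (N / 2)`
  set a : ℝ := (ε * s)⁻¹ with ha
  have hlap := integral_exp_neg_sum_sq_le hf a hlaw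
  have has : a ^ 2 * s ^ 2 = (ε⁻¹) ^ 2 := by rw [ha]; field_simp
  have hint : Integrable (fun ω => Real.exp (-(a ^ 2 / 2) * ∑ c, f c ω ^ 2)) μ := by
    refine Integrable.of_bound (Measurable.aestronglyMeasurable
      (Real.measurable_exp.comp (Measurable.const_mul
        (Finset.measurable_sum _ fun c _ => (hf c).pow_const 2) _))) 1 (ae_of_all _ fun ω => ?_)
    rw [Real.norm_of_nonneg (Real.exp_pos _).le, Real.exp_le_one_iff]
    have : 0 ≤ ∑ c, f c ω ^ 2 := Finset.sum_nonneg fun c _ => sq_nonneg _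
    have := mul_nonneg (sq_nonneg a) this
    linarith
  have hmarkov := mul_meas_ge_le_integral_of_nonneg (μ := μ)
    (ae_of_all _ fun ω => (Real.exp_pos (-(a ^ 2 / 2) * ∑ c, f c ω ^ 2)).le) hint
    (Real.exp (-(1 / 2)) ^ N)
  have hsub : {ω | ∑ c, f c ω ^ 2 ≤ ε ^ 2 * s ^ 2 * N} ⊆
      {ω | Real.exp (-(1 / 2)) ^ N ≤ Real.exp (-(a ^ 2 / 2) * ∑ c, f c ω ^ 2)} := by
    intro ω hω
    simp only [Set.mem_ofPred_eq] at hω ⊢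
    rw [← Real.exp_nat_mul, Real.exp_le_exp]
    have h3 := mul_le_mul_of_nonneg_left hω (sq_nonneg a)
    have : a ^ 2 * (ε ^ 2 * s ^ 2 * N) = N := by rw [ha]; field_simp
    linarith
  have hle := measureReal_mono (μ := μ) hsub
  have hpos : 0 < Real.exp (-(1 / 2)) ^ N := by positivity
  have h4 : Real.exp (-(1 / 2)) ^ N * μ.real {ω | ∑ c, f c ω ^ 2 ≤ ε ^ 2 * s ^ 2 * N} ≤
      ((√(1 + a ^ 2 * s ^ 2))⁻¹) ^ N :=
    (mul_le_mul_of_nonneg_left hle hpos.le).trans (hmarkov.trans hlap)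
  have h5 : (√(1 + a ^ 2 * s ^ 2))⁻¹ ≤ ε := by
    rw [has]
    apply inv_le_of_inv_le₀ hε
    apply Real.le_sqrt_of_sq_le
    linarith
  have h6 : (1 : ℝ) ≤ Real.exp (-(1 / 2)) * 2 := by
    have := Real.add_one_le_exp (-(1 / 2) : ℝ)
    linarith
  refine le_of_mul_le_mul_left (h4.trans ?_) hpos
  rw [← mul_pow (Real.exp (-(1 / 2)))]
  refine pow_le_pow_left₀ (by positivity) (h5.trans ?_) _
  nlinarith

/-- If every marginal `∑ ξ_c f_c` is a centred Gaussian with variance at most `s² |ξ|²`, then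
`∑ f_c²` has an exponential moment. -/
lemma lintegral_exp_sum_sq_le (hf : ∀ c, Measurable (f c)) (hs : 0 < s)
    (hlaw : ∀ ξ : C → ℝ, ∃ (v : ℝ≥0),
      μ.map (fun ω => ∑ c, ξ c * f c ω) = gaussianReal 0 v ∧ v ≤ s ^ 2 * ∑ c, ξ c ^ 2) :
    ∫⁻ ω, ENNReal.ofReal (Real.exp ((∑ c, f c ω ^ 2) / (4 * s ^ 2))) ∂μ ≤
      ENNReal.ofReal (√2 ^ Fintype.card C) := by
  let γ : Measure (C → ℝ) := Measure.pi fun _ => gaussianReal 0 1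
  -- with this scale the one-dimensional factors are `E exp (x² / 4) = √2`
  let a : ℝ := (√2 * s)⁻¹
  have ha2 : a ^ 2 = 1 / (2 * s ^ 2) := by
    simp only [a]
    rw [inv_pow, mul_pow, Real.sq_sqrt (by norm_num), one_div]
  let F : (C → ℝ) → Ω → ℝ≥0∞ := fun ξ ω => ENNReal.ofReal (Real.exp (a * ∑ c, ξ c * f c ω))
  have hFmeas : Measurable (Function.uncurry F) := by
    simp only [F, Function.uncurry_def]
    refine ENNReal.measurable_ofReal.comp (Real.measurable_exp.comp (Measurable.const_mul
      (Finset.measurable_sum _ fun c _ => ?_) _))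
    exact ((measurable_pi_apply c).comp measurable_fst).mul ((hf c).comp measurable_snd)
  have hinner : ∀ ω, ∫⁻ ξ, F ξ ω ∂γ =
      ENNReal.ofReal (Real.exp ((∑ c, f c ω ^ 2) / (4 * s ^ 2))) := by
    intro ω
    have h1 : ∀ ξ : C → ℝ, Real.exp (a * ∑ c, ξ c * f c ω) =
        ∏ c, Real.exp ((a * f c ω) * ξ c) := by
      intro ξ
      rw [← Real.exp_sum, Finset.mul_sum]
      congr 1
      exact Finset.sum_congr rfl fun c _ => by ring
    have hint : Integrable (fun ξ : C → ℝ => ∏ c, Real.exp ((a * f c ω) * ξ c)) γ :=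
      Integrable.fintype_prod (f := fun (c : C) x => Real.exp ((a * f c ω) * x))
        fun c => integrable_exp_mul_gaussianReal _
    simp only [F]
    simp_rw [h1]
    rw [← ofReal_integral_eq_lintegral_ofReal hint
      (ae_of_all _ fun ξ => Finset.prod_nonneg fun c _ => (Real.exp_pos _).le),
      integral_fintype_prod_eq_prod (f := fun c x => Real.exp ((a * f c ω) * x))]
    congr 1
    have h2 : ∀ t : ℝ, ∫ x, Real.exp (t * x) ∂(gaussianReal 0 1) = Real.exp (t ^ 2 / 2) := by
      intro t
      have := congrFun (mgf_fun_id_gaussianReal (μ := 0) (v := 1)) t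
      simpa [mgf] using this
    simp_rw [h2]
    rw [← Real.exp_sum, Finset.sum_div]
    congr 1
    refine Finset.sum_congr rfl fun c _ => ?_
    rw [mul_pow, ha2]
    field_simp
    ring
  have houter : ∀ ξ, ∫⁻ ω, F ξ ω ∂μ ≤ ENNReal.ofReal (∏ c, Real.exp (1 / 4 * ξ c ^ 2)) := by
    intro ξ
    obtain ⟨v, hmap, hv⟩ := hlaw ξ
    have hmeas : Measurable fun ω => ∑ c, ξ c * f c ω :=
      Finset.measurable_sum _ fun c _ => (hf c).const_mul _
    have h2 : ∫⁻ ω, F ξ ω ∂μ = ENNReal.ofReal (Real.exp (v * a ^ 2 / 2)) := by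
      have h3 : ∫⁻ ω, F ξ ω ∂μ =
          ∫⁻ x, ENNReal.ofReal (Real.exp (a * x)) ∂(μ.map (fun ω => ∑ c, ξ c * f c ω)) := by
        rw [lintegral_map (by fun_prop) hmeas]
      rw [h3, hmap, ← ofReal_integral_eq_lintegral_ofReal (integrable_exp_mul_gaussianReal _)
        (ae_of_all _ fun x => (Real.exp_pos _).le)]
      congr 1
      have := congrFun (mgf_fun_id_gaussianReal (μ := 0) (v := v)) a
      simpa [mgf] using this
    rw [h2, ← Real.exp_sum, ← Finset.mul_sum]
    refine ENNReal.ofReal_le_ofReal (Real.exp_le_exp.mpr ?_)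
    rw [ha2, mul_one_div, div_div, div_le_iff₀ (by positivity)]
    linarith
  have hswap : ∫⁻ ω, (∫⁻ ξ, F ξ ω ∂γ) ∂μ = ∫⁻ ξ, (∫⁻ ω, F ξ ω ∂μ) ∂γ :=
    (lintegral_lintegral_swap hFmeas.aemeasurable).symm
  simp_rw [hinner] at hswap
  have hq : (1 / 4 : ℝ) < 1 / 2 := by norm_num
  rw [hswap]
  refine (lintegral_mono houter).trans (le_of_eq ?_)
  rw [← ofReal_integral_eq_lintegral_ofReal
      (Integrable.fintype_prod (f := fun (_ : C) x => Real.exp (1 / 4 * x ^ 2))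
        fun c => integrable_exp_mul_sq_gaussianReal hq)
      (ae_of_all _ fun ξ => Finset.prod_nonneg fun c _ => (Real.exp_pos _).le),
    integral_fintype_prod_eq_pow fun x => Real.exp (1 / 4 * x ^ 2),
    integral_exp_mul_sq_gaussianReal hq]
  congr 2
  rw [← Real.sqrt_inv]
  norm_num

/-- Upper tail of the squared norm of a centred Gaussian vector with covariance at most `s² I`. -/
lemma measureReal_le_sum_sq_le (hf : ∀ c, Measurable (f c)) (hs : 0 < s) (t : ℝ)
    (hlaw : ∀ ξ : C → ℝ, ∃ (v : ℝ≥0),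
      μ.map (fun ω => ∑ c, ξ c * f c ω) = gaussianReal 0 v ∧ v ≤ s ^ 2 * ∑ c, ξ c ^ 2) :
    μ.real {ω | t ≤ ∑ c, f c ω ^ 2} ≤ Real.exp (-(t / (4 * s ^ 2))) * √2 ^ Fintype.card C := by
  have hmom := lintegral_exp_sum_sq_le hf hs hlaw
  have hm : Measurable fun ω => ENNReal.ofReal (Real.exp ((∑ c, f c ω ^ 2) / (4 * s ^ 2))) :=
    ENNReal.measurable_ofReal.comp (Real.measurable_exp.comp
      ((Finset.measurable_sum _ fun c _ => (hf c).pow_const 2).div_const _))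
  have hmarkov := mul_meas_ge_le_lintegral (μ := μ) hm
    (ENNReal.ofReal (Real.exp (t / (4 * s ^ 2))))
  have hsub : {ω | t ≤ ∑ c, f c ω ^ 2} ⊆ {ω | ENNReal.ofReal (Real.exp (t / (4 * s ^ 2))) ≤
      ENNReal.ofReal (Real.exp ((∑ c, f c ω ^ 2) / (4 * s ^ 2)))} := by
    intro ω hω
    refine ENNReal.ofReal_le_ofReal (Real.exp_le_exp.mpr ?_)
    exact div_le_div_of_nonneg_right hω (by positivity)
  have h := (mul_le_mul_right (measure_mono hsub) _).trans (hmarkov.trans hmom)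
  have h2 := ENNReal.toReal_mono ENNReal.ofReal_ne_top h
  rw [ENNReal.toReal_mul, ENNReal.toReal_ofReal (Real.exp_pos _).le,
    ENNReal.toReal_ofReal (by positivity)] at h2
  rw [Real.exp_neg, inv_mul_eq_div, le_div_iff₀ (Real.exp_pos _), mul_comm]
  exact h2

/-- The upper tail at `K` times the typical size, in polynomial form. -/
lemma measureReal_sq_mul_card_le_sum_sq_le (hf : ∀ c, Measurable (f c)) (hs : 0 < s) {K : ℝ}
    (hK : 0 < K)
    (hlaw : ∀ ξ : C → ℝ, ∃ (v : ℝ≥0),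
      μ.map (fun ω => ∑ c, ξ c * f c ω) = gaussianReal 0 v ∧ v ≤ s ^ 2 * ∑ c, ξ c ^ 2) :
    μ.real {ω | K ^ 2 * s ^ 2 * Fintype.card C ≤ ∑ c, f c ω ^ 2} ≤ (2 / K) ^ Fintype.card C := by
  refine (measureReal_le_sum_sq_le hf hs _ hlaw).trans ?_
  set N := Fintype.card C
  have h1 : -(K ^ 2 * s ^ 2 * N / (4 * s ^ 2)) = N * (-(K ^ 2 / 4)) := by
    field_simp
  rw [h1, Real.exp_nat_mul, ← mul_pow]
  refine pow_le_pow_left₀ (by positivity) ?_ _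
  rw [le_div_iff₀ hK, Real.exp_neg]
  have h2 : K ^ 2 / 2 ≤ Real.exp (K ^ 2 / 4) ^ 2 := by
    rw [← Real.exp_nat_mul]
    have := Real.add_one_le_exp (((2 : ℕ) : ℝ) * (K ^ 2 / 4))
    push_cast at this ⊢
    linarith
  have h3 : √2 * K ≤ 2 * Real.exp (K ^ 2 / 4) := by
    refine le_of_sq_le_sq ?_ (by positivity)
    rw [mul_pow, Real.sq_sqrt (by norm_num)]
    nlinarith
  rw [mul_assoc, inv_mul_eq_div, div_le_iff₀ (Real.exp_pos _)]
  exact h3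

end GaussianVector

/-! ### Nets and least singular values of random linear maps -/

section Nets

open Module Metric

variable {V W : Type*} [NormedAddCommGroup V] [NormedSpace ℝ V] [NormedAddCommGroup W]
  [NormedSpace ℝ W]

/-- The deterministic step of the net argument. If `M + G` contracts a unit vector `v` too much, then
`‖M v‖ ≤ 2 κ`, so that `v` is approximated by a point of the net, for `M` as well as for `G`. -/
lemma le_norm_add_apply_of_net (M G : V →ₗ[ℝ] W) {κ β δ : ℝ} {F : Finset V}
    (hκ : ∀ x, ‖G x‖ ≤ κ * ‖x‖) (hβκ : β ≤ 4 * κ) (hδκ : 12 * κ * δ ≤ β)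
    (hF2 : ∀ y ∈ F, 1 / 2 ≤ ‖y‖)
    (hnet : ∀ v : V, ‖v‖ = 1 → ‖M v‖ ≤ 2 * κ → ∃ y ∈ F, ‖v - y‖ ≤ δ ∧ ‖M (v - y)‖ ≤ 2 * κ * δ)
    (hβ : 0 ≤ β) (hF : ∀ y ∈ F, β * ‖y‖ ≤ ‖(M + G) y‖) (v : V) :
    β / 4 * ‖v‖ ≤ ‖(M + G) v‖ := by
  have hunit : ∀ v : V, ‖v‖ = 1 → β / 4 ≤ ‖(M + G) v‖ := by
    intro v hv
    by_contra! hlt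
    have hGv := hκ v
    rw [hv, mul_one] at hGv
    have hMv : ‖M v‖ ≤ 2 * κ := by
      have h : M v = (M + G) v - G v := by simp
      rw [h]
      refine (norm_sub_le _ _).trans ?_
      linarith
    obtain ⟨y, hy, h1, h2⟩ := hnet v hv hMv
    have hκ0 : 0 ≤ κ := (norm_nonneg _).trans hGv
    have h3 : (M + G) y = (M + G) v - (M (v - y) + G (v - y)) := by
      simp only [LinearMap.add_apply, map_sub]; abel
    have h4 : ‖(M + G) y‖ ≤ ‖(M + G) v‖ + (‖M (v - y)‖ + ‖G (v - y)‖) := by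
      rw [h3]
      exact (norm_sub_le _ _).trans (add_le_add le_rfl (norm_add_le _ _))
    have h5 : ‖G (v - y)‖ ≤ κ * δ := (hκ _).trans (mul_le_mul_of_nonneg_left h1 hκ0)
    have h6 := hF y hy
    have h7 : β * (1 / 2) ≤ β * ‖y‖ := mul_le_mul_of_nonneg_left (hF2 y hy) hβ
    linarith
  rcases eq_or_ne v 0 with rfl | hv
  · simp
  have hv' : 0 < ‖v‖ := norm_pos_iff.mpr hv
  have h := hunit (‖v‖⁻¹ • v) (by rw [norm_smul, norm_inv, norm_norm, inv_mul_cancel₀ hv'.ne'])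
  rw [map_smul, norm_smul, norm_inv, norm_norm, inv_mul_eq_div, le_div_iff₀ hv'] at h
  exact h

variable [FiniteDimensional ℝ V]

lemma card_le_of_separated_unitBall {δ : ℝ} (hδ : 0 < δ) (hδ1 : δ ≤ 1) (F : Finset V)
    (hF : ∀ x ∈ F, ‖x‖ ≤ 1) (hsep : ∀ x ∈ F, ∀ y ∈ F, x ≠ y → δ ≤ ‖x - y‖) :
    (F.card : ℝ) ≤ (3 / δ) ^ finrank ℝ V := by
  borelize V
  let μ : Measure V := Measure.addHaar
  have hδ2 : 0 < δ / 2 := by positivity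
  have hd : Set.Pairwise (F : Set V) (Function.onFun Disjoint fun c => ball c (δ / 2)) := by
    intro c hc d hd hcd
    apply ball_disjoint_ball
    rw [dist_eq_norm]
    have := hsep c hc d hd hcd
    linarith
  have hsub : (⋃ c ∈ F, ball c (δ / 2)) ⊆ ball (0 : V) (3 / 2) := by
    refine Set.iUnion₂_subset fun x hx => ball_subset_ball' ?_
    rw [dist_zero_right]
    have := hF x hx
    linarith
  have h1 : (F.card : ℝ≥0∞) * ENNReal.ofReal ((δ / 2) ^ finrank ℝ V) * μ (ball 0 1) ≤
      ENNReal.ofReal ((3 / 2) ^ finrank ℝ V) * μ (ball 0 1) :=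
    calc
      _ = μ (⋃ c ∈ F, ball c (δ / 2)) := by
        rw [measure_biUnion_finset hd fun c _ => measurableSet_ball]
        simp only [μ.addHaar_ball_of_pos _ hδ2]
        simp only [Finset.sum_const, nsmul_eq_mul, mul_assoc]
      _ ≤ μ (ball (0 : V) (3 / 2)) := measure_mono hsub
      _ = _ := by rw [μ.addHaar_ball_of_pos _ (by norm_num)]
  have h2 := (ENNReal.mul_le_mul_iff_left (measure_ball_pos _ _ zero_lt_one).ne'
    measure_ball_lt_top.ne).1 h1
  have h3 := ENNReal.toReal_le_of_le_ofReal (by positivity) h2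
  rw [ENNReal.toReal_mul, ENNReal.toReal_natCast, ENNReal.toReal_ofReal (by positivity),
    ← le_div_iff₀ (by positivity), ← div_pow] at h3
  refine h3.trans (le_of_eq ?_)
  congr 1
  field_simp

/-- The unit ball of a finite-dimensional normed space has a `δ`-net with at most
`(3 / δ) ^ dim` points. -/
lemma exists_net_unitBall {δ : ℝ} (hδ : 0 < δ) (hδ1 : δ ≤ 1) :
    ∃ F : Finset V, (∀ y ∈ F, ‖y‖ ≤ 1) ∧ (F.card : ℝ) ≤ (3 / δ) ^ finrank ℝ V ∧
      ∀ x : V, ‖x‖ ≤ 1 → ∃ y ∈ F, ‖x - y‖ ≤ δ := by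
  classical
  -- a separated set of maximal cardinality is a net
  let S : Set ℕ := {N | ∃ F : Finset V, (∀ x ∈ F, ‖x‖ ≤ 1) ∧
    (∀ x ∈ F, ∀ y ∈ F, x ≠ y → δ ≤ ‖x - y‖) ∧ F.card = N}
  have hne : S.Nonempty := ⟨0, ∅, by simp, by simp, rfl⟩
  have hbdd : BddAbove S := by
    refine ⟨⌊(3 / δ) ^ finrank ℝ V⌋₊, ?_⟩
    rintro _ ⟨F, h1, h2, rfl⟩
    exact Nat.le_floor (card_le_of_separated_unitBall hδ hδ1 F h1 h2)
  obtain ⟨F, h1, h2, h3⟩ := Nat.sSup_mem hne hbdd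
  refine ⟨F, h1, card_le_of_separated_unitBall hδ hδ1 F h1 h2, fun x hx => ?_⟩
  by_contra! hcon
  have hxF : x ∉ F := fun h => by
    have := hcon x h
    rw [sub_self, norm_zero] at this
    exact absurd this (not_lt.mpr hδ.le)
  have hmem : F.card + 1 ∈ S := by
    refine ⟨insert x F, ?_, ?_, Finset.card_insert_of_notMem hxF⟩
    · intro y hy
      rcases Finset.mem_insert.mp hy with rfl | hy
      exacts [hx, h1 y hy]
    · intro y hy z hz hyz
      rcases Finset.mem_insert.mp hy with hy' | hy' <;>
        rcases Finset.mem_insert.mp hz with hz' | hz'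
      · exact absurd (hy'.trans hz'.symm) hyz
      · rw [hy']; exact (hcon z hz').le
      · rw [hz', norm_sub_rev]; exact (hcon y hy').le
      · exact h2 y hy' z hz' hyz
  have := le_csSup hbdd hmem
  omega

lemma norm_apply_le_of_net (G : V →ₗ[ℝ] W) {F : Finset V} {τ : ℝ}
    (hnet : ∀ x : V, ‖x‖ ≤ 1 → ∃ y ∈ F, ‖x - y‖ ≤ 1 / 2) (hF : ∀ y ∈ F, ‖G y‖ ≤ τ) (x : V) :
    ‖G x‖ ≤ 2 * τ * ‖x‖ := by
  let G' : V →L[ℝ] W := LinearMap.toContinuousLinearMap G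
  have hG' : ∀ x, G' x = G x := fun x => rfl
  have hτ : 0 ≤ τ := by
    obtain ⟨y, hy, -⟩ := hnet 0 (by simp)
    exact (norm_nonneg _).trans (hF y hy)
  have hunit : ∀ x : V, ‖x‖ = 1 → ‖G' x‖ ≤ τ + ‖G'‖ * (1 / 2) := by
    intro x hx
    obtain ⟨y, hy, hxy⟩ := hnet x hx.le
    calc ‖G' x‖ = ‖G' y + G' (x - y)‖ := by rw [← map_add]; congr 2; abel
      _ ≤ ‖G' y‖ + ‖G' (x - y)‖ := norm_add_le _ _
      _ ≤ τ + ‖G'‖ * (1 / 2) := by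
        refine add_le_add (hF y hy) ((G'.le_opNorm _).trans ?_)
        gcongr
  have hle : ‖G'‖ ≤ τ + ‖G'‖ * (1 / 2) :=
    ContinuousLinearMap.opNorm_le_of_unit_norm (by positivity) hunit
  calc ‖G x‖ = ‖G' x‖ := rfl
    _ ≤ ‖G'‖ * ‖x‖ := G'.le_opNorm x
    _ ≤ 2 * τ * ‖x‖ := by gcongr; linarith

/-- A net of the set of vectors `v` of norm one with `‖M v‖ ≤ a`, fine both for the norm and for
`‖M ·‖ / a`. Its size does not depend on `M`, because it is obtained from a net of the unit ball
of the graph of `M / a`. -/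
lemma exists_net_of_norm_apply_le (M : V →ₗ[ℝ] W) {a δ : ℝ} (ha : 0 < a) (hδ : 0 < δ)
    (hδ1 : δ ≤ 1 / 2) :
    ∃ F : Finset V, (F.card : ℝ) ≤ (3 / δ) ^ finrank ℝ V ∧ (∀ y ∈ F, 1 / 2 ≤ ‖y‖) ∧
      ∀ v : V, ‖v‖ = 1 → ‖M v‖ ≤ a → ∃ y ∈ F, ‖v - y‖ ≤ δ ∧ ‖M (v - y)‖ ≤ a * δ := by
  classical
  let L : V →ₗ[ℝ] V × W := LinearMap.prod LinearMap.id (a⁻¹ • M)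
  have hL : ∀ v, L v = (v, a⁻¹ • M v) := fun v => rfl
  have hLinj : Function.Injective L := fun v w h => by
    rw [hL, hL, Prod.mk.injEq] at h
    exact h.1
  obtain ⟨F, -, hcard, hnet⟩ := exists_net_unitBall (V := LinearMap.range L) hδ (by linarith)
  rw [LinearMap.finrank_range_of_inj hLinj] at hcard
  let F' : Finset V := (F.image fun y : LinearMap.range L => (y : V × W).1).filter fun y => 1 / 2 ≤ ‖y‖
  refine ⟨F', ?_, ?_, ?_⟩
  · refine le_trans ?_ hcard
    exact_mod_cast (Finset.card_filter_le _ _).trans Finset.card_image_le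
  · intro y hy
    exact (Finset.mem_filter.mp hy).2
  · intro v hv hMv
    have hball : ‖(⟨L v, LinearMap.mem_range_self L v⟩ : LinearMap.range L)‖ ≤ 1 := by
      change ‖L v‖ ≤ 1
      rw [hL, Prod.norm_mk, norm_smul, Real.norm_of_nonneg (by positivity)]
      refine max_le hv.le ?_
      rw [inv_mul_le_iff₀ ha]
      linarith
    obtain ⟨⟨_, w, rfl⟩, hyF, hy⟩ := hnet _ hball
    change ‖L v - L w‖ ≤ δ at hy
    rw [← map_sub, hL, Prod.norm_mk, norm_smul, Real.norm_of_nonneg (by positivity)] at hy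
    have h1 := (le_max_left _ _).trans hy
    have h2 := (le_max_right _ _).trans hy
    rw [inv_mul_le_iff₀ ha] at h2
    refine ⟨w, ?_, h1, h2⟩
    refine Finset.mem_filter.mpr ⟨Finset.mem_image.mpr ⟨_, hyF, rfl⟩, ?_⟩
    have := norm_sub_norm_le v w
    linarith

variable {Ω : Type*} [MeasurableSpace Ω] {μ : Measure Ω}

/-- A bound on the operator norm of a random linear map, from a tail bound for each fixed
vector. -/
lemma exists_event_norm_apply_le (G : Ω → V →ₗ[ℝ] W) {τ p : ℝ}
    (hmeas : ∀ v, Measurable fun ω => ‖G ω v‖)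
    (hp : ∀ v, ‖v‖ ≤ 1 → μ.real {ω | τ ≤ ‖G ω v‖} ≤ p) :
    ∃ E : Set Ω, MeasurableSet E ∧ μ.real Eᶜ ≤ 6 ^ finrank ℝ V * p ∧
      ∀ ω ∈ E, ∀ x, ‖G ω x‖ ≤ 2 * τ * ‖x‖ := by
  obtain ⟨F, hF1, hcard, hnet⟩ := exists_net_unitBall (V := V) (δ := 1 / 2) (by norm_num)
    (by norm_num)
  have hp0 : 0 ≤ p := measureReal_nonneg.trans (hp 0 (by simp))
  refine ⟨(⋃ y ∈ F, {ω | τ ≤ ‖G ω y‖})ᶜ, ?_, ?_, ?_⟩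
  · exact (Finset.measurableSet_biUnion F fun y _ =>
      measurableSet_le measurable_const (hmeas y)).compl
  · rw [compl_compl]
    refine (measureReal_biUnion_finset_le F _).trans ?_
    refine (Finset.sum_le_card_nsmul F _ p fun y hy => hp y (hF1 y hy)).trans ?_
    rw [nsmul_eq_mul]
    refine mul_le_mul_of_nonneg_right (hcard.trans (le_of_eq ?_)) hp0
    norm_num
  · intro ω hω x
    simp only [Set.mem_compl_iff, Set.mem_iUnion, Set.mem_ofPred_eq, not_exists, not_le] at hω
    exact norm_apply_le_of_net (G ω) hnet (fun y hy => (hω y hy).le) x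

/-- A lower bound for the least singular value of `M + G`, with `M` fixed and `G` random, from an
operator norm bound for `G` and a small ball bound for each fixed vector. It does not depend on
the size of `M`. -/
lemma exists_event_le_norm_add_apply (M : V →ₗ[ℝ] W) (G : Ω → V →ₗ[ℝ] W) {κ β δ p : ℝ}
    (hmeas : ∀ v, Measurable fun ω => ‖(M + G ω) v‖) (hκ : 0 < κ) (hβ : 0 < β) (hδ : 0 < δ)
    (hδ1 : δ ≤ 1 / 2) (hβκ : β ≤ 4 * κ) (hδκ : 12 * κ * δ ≤ β) (hp0 : 0 ≤ p)
    (hp : ∀ v, v ≠ 0 → μ.real {ω | ‖(M + G ω) v‖ ≤ β * ‖v‖} ≤ p) :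
    ∃ E : Set Ω, MeasurableSet E ∧ μ.real Eᶜ ≤ (3 / δ) ^ finrank ℝ V * p ∧
      ∀ ω ∈ E, (∀ x, ‖G ω x‖ ≤ κ * ‖x‖) → ∀ v, β / 4 * ‖v‖ ≤ ‖(M + G ω) v‖ := by
  obtain ⟨F, hcard, hF2, hnet⟩ := exists_net_of_norm_apply_le M (a := 2 * κ) (by positivity) hδ hδ1
  refine ⟨(⋃ y ∈ F, {ω | ‖(M + G ω) y‖ ≤ β * ‖y‖})ᶜ, ?_, ?_, ?_⟩
  · exact (Finset.measurableSet_biUnion F fun y _ =>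
      measurableSet_le (hmeas y) measurable_const).compl
  · rw [compl_compl]
    refine (measureReal_biUnion_finset_le F _).trans ?_
    refine (Finset.sum_le_card_nsmul F _ p fun y hy => hp y ?_).trans ?_
    · have := hF2 y hy
      exact norm_pos_iff.mp (by linarith)
    rw [nsmul_eq_mul]
    exact mul_le_mul_of_nonneg_right hcard hp0
  · intro ω hω hG v
    simp only [Set.mem_compl_iff, Set.mem_iUnion, Set.mem_ofPred_eq, not_exists, not_le] at hω
    exact le_norm_add_apply_of_net M (G ω) hG hβκ hδκ hF2 hnet hβ.le
      (fun y hy => (hω y hy).le) v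

end Nets

/-! ### Singular values -/

section SingularValues

open Module

variable {E F V : Type*} [NormedAddCommGroup E] [InnerProductSpace ℝ E] [FiniteDimensional ℝ E]
  [NormedAddCommGroup F] [InnerProductSpace ℝ F] [FiniteDimensional ℝ F]
  [NormedAddCommGroup V] [InnerProductSpace ℝ V] [FiniteDimensional ℝ V]

/-- One half of the Courant–Fischer theorem: a linear map that expands an `r + 1`-dimensional
subspace by a factor of at least `c` has at least `r + 1` singular values that are at least `c`. -/
lemma LinearMap.le_singularValues_of_finrank (T : E →ₗ[ℝ] F) (S : Submodule ℝ E) {r : ℕ}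
    (hS : r < finrank ℝ S) {c : ℝ} (h : ∀ x ∈ S, c * ‖x‖ ≤ ‖T x‖) :
    c ≤ T.singularValues r := by
  have hrE : r < finrank ℝ E := hS.trans_le S.finrank_le
  have hsym := T.isSymmetric_adjoint_comp_self
  let b := hsym.eigenvectorBasis rfl
  -- the span of the eigenvectors from index `r` on meets `S` for dimension reasons
  let U : Submodule ℝ E := Submodule.span ℝ (Set.range fun j : Set.Ici (⟨r, hrE⟩ : Fin _) => b j)
  have hU : finrank ℝ U = finrank ℝ E - r := by
    have hli : LinearIndependent ℝ fun j : Set.Ici (⟨r, hrE⟩ : Fin _) => b j :=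
      b.orthonormal.linearIndependent.comp _ Subtype.val_injective
    rw [finrank_span_eq_card hli]
    simp
  have hinf : S ⊓ U ≠ ⊥ := by
    intro hbot
    have h1 := Submodule.finrank_sup_add_finrank_inf_eq S U
    rw [hbot, finrank_bot, hU] at h1
    have := (S ⊔ U).finrank_le
    omega
  obtain ⟨x, hx, hx0⟩ := Submodule.exists_mem_ne_zero_of_ne_bot hinf
  have hcoord : ∀ i : Fin (finrank ℝ E), i.1 < r → inner ℝ (b i) x = 0 := by
    intro i hi
    have hle : U ≤ (ℝ ∙ b i)ᗮ := by
      refine Submodule.span_le.mpr ?_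
      rintro _ ⟨j, rfl⟩
      refine Submodule.mem_orthogonal_singleton_iff_inner_right.mpr ?_
      refine b.orthonormal.2 fun hij => ?_
      have : r ≤ j.1.1 := j.2
      rw [← hij] at this
      omega
    exact Submodule.mem_orthogonal_singleton_iff_inner_right.mp (hle hx.2)
  have hTx : ‖T x‖ ^ 2 = ∑ i, hsym.eigenvalues rfl i * inner ℝ (b i) x ^ 2 := by
    have h1 : ‖T x‖ ^ 2 = inner ℝ x ((T.adjoint ∘ₗ T) x) := by
      rw [LinearMap.comp_apply, LinearMap.adjoint_inner_right, real_inner_self_eq_norm_sq]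
    rw [h1, ← b.sum_inner_mul_inner]
    refine Finset.sum_congr rfl fun i _ => ?_
    rw [← hsym (b i) x, hsym.apply_eigenvectorBasis, real_inner_comm]
    simp only [RCLike.ofReal_real_eq_id, id_eq, inner_smul_left, conj_trivial]
    rw [real_inner_comm]
    ring
  have hle : ‖T x‖ ^ 2 ≤ T.singularValues r ^ 2 * ‖x‖ ^ 2 := by
    rw [hTx, ← b.sum_sq_norm_inner_right x, Finset.mul_sum]
    refine Finset.sum_le_sum fun i _ => ?_
    rw [Real.norm_eq_abs, sq_abs]
    by_cases hi : i.1 < r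
    · rw [hcoord i hi]; simp
    · refine mul_le_mul_of_nonneg_right ?_ (sq_nonneg _)
      rw [T.sq_singularValues_of_lt rfl hrE]
      exact hsym.eigenvalues_antitone rfl (not_lt.mp hi)
  have hxpos : 0 < ‖x‖ := norm_pos_iff.mpr hx0
  have h2 := h x hx.1
  have h3 : ‖T x‖ ≤ T.singularValues r * ‖x‖ := by
    refine le_of_sq_le_sq (by rwa [mul_pow]) (mul_nonneg (T.singularValues_nonneg r) hxpos.le)
  exact le_of_mul_le_mul_right (h2.trans h3) hxpos

/-- An expanding map `B` has an adjoint that expands on the range of `B`: pair `B* B v` with `v`. -/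
lemma LinearMap.le_norm_adjoint_apply {B : V →ₗ[ℝ] E} {β : ℝ}
    (hB : ∀ v, β * ‖v‖ ≤ ‖B v‖) (v : V) : β * ‖B v‖ ≤ ‖B.adjoint (B v)‖ := by
  rcases eq_or_ne v 0 with rfl | hv
  · simp
  have hv' : 0 < ‖v‖ := norm_pos_iff.mpr hv
  have h1 : ‖B v‖ ^ 2 ≤ ‖B.adjoint (B v)‖ * ‖v‖ := by
    rw [← real_inner_self_eq_norm_sq, ← LinearMap.adjoint_inner_left]
    exact real_inner_le_norm _ _
  have h2 := hB v
  refine le_of_mul_le_mul_right ?_ hv'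
  calc β * ‖B v‖ * ‖v‖ = (β * ‖v‖) * ‖B v‖ := by ring
    _ ≤ ‖B v‖ * ‖B v‖ := mul_le_mul_of_nonneg_right h2 (norm_nonneg _)
    _ = ‖B v‖ ^ 2 := by ring
    _ ≤ _ := h1

/-- If `A` and `B` expand by factors `α` and `β`, then `A ∘ B*` has as many singular values that
are at least `α β` as the dimension of their common source: use the range of `B`. -/
lemma LinearMap.le_singularValues_comp_adjoint (A : V →ₗ[ℝ] F) (B : V →ₗ[ℝ] E) {α β : ℝ}
    (hα : 0 ≤ α) (hβ : 0 < β) (hA : ∀ v, α * ‖v‖ ≤ ‖A v‖) (hB : ∀ v, β * ‖v‖ ≤ ‖B v‖) {r : ℕ}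
    (hr : r < finrank ℝ V) : α * β ≤ (A ∘ₗ B.adjoint).singularValues r := by
  have hBinj : Function.Injective B := by
    rw [injective_iff_map_eq_zero]
    intro v hv
    have := hB v
    rw [hv, norm_zero] at this
    exact norm_le_zero_iff.mp (nonpos_of_mul_nonpos_right this hβ)
  refine LinearMap.le_singularValues_of_finrank _ (LinearMap.range B)
    (by rwa [LinearMap.finrank_range_of_inj hBinj]) ?_
  rintro _ ⟨v, rfl⟩
  calc α * β * ‖B v‖ = α * (β * ‖B v‖) := by ring
    _ ≤ α * ‖B.adjoint (B v)‖ :=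
      mul_le_mul_of_nonneg_left (LinearMap.le_norm_adjoint_apply hB v) hα
    _ ≤ _ := hA _

lemma LinearMap.adjoint_surjective_of_injective {B : V →ₗ[ℝ] E} (hB : Function.Injective B) :
    Function.Surjective B.adjoint := by
  rw [← LinearMap.range_eq_top, ← LinearMap.orthogonal_ker,
    LinearMap.ker_eq_bot.mpr hB, Submodule.bot_orthogonal_eq_top]

end SingularValues

/-! ### Linear functionals of the perturbation -/

section Perturbation

variable {n k : ℕ}

instance (ρ : ℝ) : IsProbabilityMeasure (perturbationLaw n k ρ) := by
  unfold perturbationLaw; infer_instance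

lemma perturbation_comm (g : UpperEntries n k) (i : Fin k) (a b : Fin n) :
    perturbation g i a b = perturbation g i b a := by
  simp only [perturbation, Matrix.of_apply]
  rcases lt_trichotomy a b with h | h | h
  · rw [dif_pos h, dif_neg h.not_gt, dif_pos h]
  · subst h; rfl
  · rw [dif_neg h.not_gt, dif_pos h, dif_pos h]

@[simp]
lemma perturbation_self (g : UpperEntries n k) (i : Fin k) (a : Fin n) :
    perturbation g i a a = 0 := by
  simp [perturbation]

lemma perturbation_of_lt (g : UpperEntries n k) (i : Fin k)
    (p : {p : Fin n × Fin n // p.1 < p.2}) : perturbation g i p.1.1 p.1.2 = g i p := by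
  simp [perturbation, p.2]

@[fun_prop]
lemma measurable_perturbation (i : Fin k) (a b : Fin n) :
    Measurable fun g : UpperEntries n k => perturbation g i a b := by
  simp only [perturbation, Matrix.of_apply]
  split_ifs <;> fun_prop

lemma sum_sum_eq_sum_lt (φ : Fin n → Fin n → ℝ) (hφ : ∀ a, φ a a = 0) :
    ∑ a, ∑ b, φ a b =
      ∑ p : {p : Fin n × Fin n // p.1 < p.2}, (φ p.1.1 p.1.2 + φ p.1.2 p.1.1) := by
  have h1 : ∀ ψ : Fin n → Fin n → ℝ, ∑ p : {p : Fin n × Fin n // p.1 < p.2}, ψ p.1.1 p.1.2 =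
      ∑ a, ∑ b, if a < b then ψ a b else 0 := by
    intro ψ
    rw [← Fintype.sum_prod_type' (f := fun a b => if a < b then ψ a b else 0),
      ← Finset.sum_filter]
    exact (Finset.sum_subtype (Finset.univ.filter fun p : Fin n × Fin n => p.1 < p.2)
      (by simp) (fun p : Fin n × Fin n => ψ p.1 p.2)).symm
  rw [Finset.sum_add_distrib, h1, h1 fun a b => φ b a,
    Finset.sum_comm (f := fun a b => if a < b then φ b a else 0), ← Finset.sum_add_distrib]
  refine Finset.sum_congr rfl fun a _ => ?_
  rw [← Finset.sum_add_distrib]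
  refine Finset.sum_congr rfl fun b _ => ?_
  rcases lt_trichotomy a b with h | h | h
  · simp [h, h.not_gt]
  · subst h; simp [hφ]
  · simp [h, h.not_gt]

lemma sum_mul_perturbation (W : Fin n → Fin n → ℝ) (g : UpperEntries n k) (i : Fin k) :
    ∑ a, ∑ b, W a b * perturbation g i a b =
      ∑ p : {p : Fin n × Fin n // p.1 < p.2}, (W p.1.1 p.1.2 + W p.1.2 p.1.1) * g i p := by
  rw [sum_sum_eq_sum_lt _ (by simp)]
  refine Finset.sum_congr rfl fun p _ => ?_
  rw [perturbation_comm g i p.1.2 p.1.1, perturbation_of_lt]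
  ring

/-- A linear functional of the entries is Gaussian, by its characteristic function. -/
lemma map_perturbationLaw_sum (ρ : ℝ) (A : Fin k → {p : Fin n × Fin n // p.1 < p.2} → ℝ) :
    (perturbationLaw n k ρ).map (fun g => ∑ i, ∑ p, A i p * g i p) =
      gaussianReal 0 (Real.toNNReal (ρ ^ 2 * ∑ i, ∑ p, A i p ^ 2)) := by
  have hmeas : Measurable fun g : UpperEntries n k => ∑ i, ∑ p, A i p * g i p := by fun_prop
  have : IsProbabilityMeasure
      ((perturbationLaw n k ρ).map (fun g => ∑ i, ∑ p, A i p * g i p)) :=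
    Measure.isProbabilityMeasure_map hmeas.aemeasurable
  refine Measure.ext_of_charFun (funext fun t => ?_)
  rw [charFun_apply_real, integral_map hmeas.aemeasurable
    (Measurable.aestronglyMeasurable (by fun_prop)), charFun_gaussianReal]
  have h1 : ∀ g : UpperEntries n k,
      Complex.exp ((t : ℂ) * ((∑ i, ∑ p, A i p * g i p : ℝ) : ℂ) * Complex.I) =
        ∏ i, ∏ p, Complex.exp (((t * A i p : ℝ) : ℂ) * (g i p : ℝ) * Complex.I) := by
    intro g
    simp_rw [← Complex.exp_sum]
    congr 1
    push_cast
    rw [Finset.mul_sum, Finset.sum_mul]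
    refine Finset.sum_congr rfl fun i _ => ?_
    rw [Finset.mul_sum, Finset.sum_mul]
    exact Finset.sum_congr rfl fun p _ => by ring
  simp_rw [h1]
  unfold perturbationLaw
  rw [integral_fintype_prod_eq_prod (f := fun (i : Fin k)
    (x : {p : Fin n × Fin n // p.1 < p.2} → ℝ) =>
      ∏ p, Complex.exp (((t * A i p : ℝ) : ℂ) * (x p : ℝ) * Complex.I))]
  have h2 : ∀ i, ∫ x : {p : Fin n × Fin n // p.1 < p.2} → ℝ,
      ∏ p, Complex.exp (((t * A i p : ℝ) : ℂ) * (x p : ℝ) * Complex.I)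
        ∂(Measure.pi fun _ => gaussianReal 0 (Real.toNNReal (ρ ^ 2))) =
      ∏ p, Complex.exp (-(ρ ^ 2 * (t * A i p) ^ 2 / 2)) := by
    intro i
    rw [integral_fintype_prod_eq_prod (f := fun (p : {p : Fin n × Fin n // p.1 < p.2}) (x : ℝ) =>
      Complex.exp (((t * A i p : ℝ) : ℂ) * (x : ℝ) * Complex.I))]
    simp_rw [← charFun_apply_real, charFun_gaussianReal]
    refine Finset.prod_congr rfl fun p _ => ?_
    rw [Real.coe_toNNReal _ (sq_nonneg ρ)]
    push_cast
    congr 1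
    ring
  simp_rw [h2, ← Complex.exp_sum]
  rw [Real.coe_toNNReal _ (mul_nonneg (sq_nonneg ρ)
    (Finset.sum_nonneg fun i _ => Finset.sum_nonneg fun p _ => sq_nonneg _))]
  congr 1
  push_cast
  rw [mul_zero, zero_mul, zero_sub, Finset.mul_sum, Finset.sum_mul, Finset.sum_div,
    ← Finset.sum_neg_distrib]
  refine Finset.sum_congr rfl fun i _ => ?_
  rw [Finset.mul_sum, Finset.sum_mul, Finset.sum_div, ← Finset.sum_neg_distrib]
  exact Finset.sum_congr rfl fun p _ => by ring

/-- The variance, up to the factor `ρ²`, of the linear functional `∑ W_i[a, b] Δ_i[a, b]` of the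
perturbation. -/
def perturbationVariance (W : Fin k → Fin n → Fin n → ℝ) : ℝ :=
  ∑ i, ∑ p : {p : Fin n × Fin n // p.1 < p.2}, (W i p.1.1 p.1.2 + W i p.1.2 p.1.1) ^ 2

lemma map_perturbationLaw_functional (ρ m : ℝ) (W : Fin k → Fin n → Fin n → ℝ) :
    (perturbationLaw n k ρ).map
        (fun g => m + ∑ i, ∑ a, ∑ b, W i a b * perturbation g i a b) =
      gaussianReal m (Real.toNNReal (ρ ^ 2 * perturbationVariance W)) := by
  have h := map_perturbationLaw_sum ρ fun (i : Fin k) (p : {p : Fin n × Fin n // p.1 < p.2}) =>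
    W i p.1.1 p.1.2 + W i p.1.2 p.1.1
  simp_rw [← sum_mul_perturbation] at h
  have h2 := congrArg (fun ν => Measure.map (fun x => m + x) ν) h
  rw [Measure.map_map (by fun_prop) (by fun_prop), gaussianReal_map_const_add, zero_add] at h2
  exact h2

lemma perturbationVariance_nonneg (W : Fin k → Fin n → Fin n → ℝ) : 0 ≤ perturbationVariance W :=
  Finset.sum_nonneg fun _ _ => Finset.sum_nonneg fun _ _ => sq_nonneg _

lemma perturbationVariance_le (W : Fin k → Fin n → Fin n → ℝ) :
    perturbationVariance W ≤ 2 * ∑ i, ∑ a, ∑ b, W i a b ^ 2 := by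
  rw [perturbationVariance, Finset.mul_sum]
  refine Finset.sum_le_sum fun i _ => ?_
  have h1 : ∑ a, ∑ b, (if a = b then 0 else W i a b ^ 2) ≤ ∑ a, ∑ b, W i a b ^ 2 := by
    refine Finset.sum_le_sum fun a _ => Finset.sum_le_sum fun b _ => ?_
    split_ifs
    exacts [sq_nonneg _, le_rfl]
  rw [sum_sum_eq_sum_lt _ (by simp)] at h1
  refine le_trans ?_ (mul_le_mul_of_nonneg_left h1 zero_le_two)
  rw [Finset.mul_sum]
  refine Finset.sum_le_sum fun p _ => ?_
  rw [if_neg p.2.ne, if_neg p.2.ne']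
  nlinarith [sq_nonneg (W i p.1.1 p.1.2 - W i p.1.2 p.1.1)]

/-- The entries with row in `P` and column in `Q` are independent when `P` and `Q` are disjoint,
which bounds the variance from below. -/
lemma le_perturbationVariance (W : Fin k → Fin n → Fin n → ℝ) {P Q : Finset (Fin n)}
    (hPQ : Disjoint P Q) (hW : ∀ i, ∀ a ∈ P, ∀ b ∈ Q, W i b a = 0) :
    ∑ i, ∑ a ∈ P, ∑ b ∈ Q, W i a b ^ 2 ≤ perturbationVariance W := by
  refine Finset.sum_le_sum fun i _ => ?_
  let φ : Fin n → Fin n → ℝ := fun a b => if a ∈ P ∧ b ∈ Q then W i a b ^ 2 else 0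
  have h1 : ∑ a ∈ P, ∑ b ∈ Q, W i a b ^ 2 = ∑ a, ∑ b, φ a b := by
    simp only [φ, ite_and, Finset.sum_ite_mem, Finset.univ_inter, Finset.sum_ite_irrel,
      Finset.sum_const_zero]
  have hd : ∀ a ∈ P, a ∉ Q := fun a ha => Finset.disjoint_left.mp hPQ ha
  rw [h1, sum_sum_eq_sum_lt φ fun a => if_neg fun h => hd a h.1 h.2]
  refine Finset.sum_le_sum fun p _ => ?_
  simp only [φ]
  by_cases h : p.1.1 ∈ P ∧ p.1.2 ∈ Q
  · rw [if_pos h, if_neg fun h' => hd _ h.1 h'.2, hW i _ h.1 _ h.2, add_zero,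
      add_zero]
  · rw [if_neg h]
    by_cases h' : p.1.2 ∈ P ∧ p.1.1 ∈ Q
    · rw [if_pos h', hW i _ h'.1 _ h'.2]; simp
    · rw [if_neg h', add_zero]; positivity

section Families

variable {κ : Type*} [DecidableEq κ] {s : Finset κ} {f : κ → UpperEntries n k → ℝ}
  {W : (κ → ℝ) → Fin k → Fin n → Fin n → ℝ} {ρ σ : ℝ}

/-- Small ball bound for affine functions `f_c`, `c ∈ s`, of the perturbation. The coefficients of
`∑ ξ_c f_c` are given by `W ξ`, its constant term by `m ξ`, and its variance is bounded below by the
coefficients in `P × Q`. It is enough to consider `ξ` that vanish off `s`, so that sums over `s` become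
sums over the whole index type. -/
lemma perturbationLaw_sum_sq_le_le (hf : ∀ c, Measurable (f c)) (hρ : 0 < ρ) (hσ : 0 < σ) {ε : ℝ}
    (hε : 0 < ε) (m : (κ → ℝ) → ℝ) {P Q : Finset (Fin n)} (hPQ : Disjoint P Q)
    (hfW : ∀ ξ : κ → ℝ, (∀ c ∉ s, ξ c = 0) → ∀ g, ∑ c ∈ s, ξ c * f c g =
      m ξ + ∑ i, ∑ a, ∑ b, W ξ i a b * perturbation g i a b)
    (hW : ∀ ξ : κ → ℝ, (∀ c ∉ s, ξ c = 0) → ∀ i, ∀ a ∈ P, ∀ b ∈ Q, W ξ i b a = 0)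
    (hσW : ∀ ξ : κ → ℝ, (∀ c ∉ s, ξ c = 0) →
      σ ^ 2 * ∑ c ∈ s, ξ c ^ 2 ≤ ∑ i, ∑ a ∈ P, ∑ b ∈ Q, W ξ i a b ^ 2) :
    (perturbationLaw n k ρ).real {g | ∑ c ∈ s, f c g ^ 2 ≤ ε ^ 2 * (ρ * σ) ^ 2 * s.card} ≤
      (2 * ε) ^ s.card := by
  have h := measureReal_sum_sq_le_le (μ := perturbationLaw n k ρ) (f := fun c : s => f c)
    (s := ρ * σ) (fun c => hf c) (mul_pos hρ hσ) hε ?_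
  · rw [Fintype.card_coe] at h
    exact (congrArg _ (Set.ext fun g => by
      simp only [Set.mem_ofPred_eq, Finset.sum_coe_sort s fun c => f c g ^ 2])).trans_le h
  · intro ξ
    let ξ' : κ → ℝ := fun c => if h : c ∈ s then ξ ⟨c, h⟩ else 0
    have hξ' : ∀ c : s, ξ c = ξ' c := fun c => by simp [ξ']
    have hsupp : ∀ c ∉ s, ξ' c = 0 := fun c hc => by simp [ξ', hc]
    refine ⟨m ξ', Real.toNNReal (ρ ^ 2 * perturbationVariance (W ξ')), ?_, ?_⟩
    · rw [← map_perturbationLaw_functional]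
      congr 1
      funext g
      rw [← hfW ξ' hsupp, ← Finset.sum_coe_sort s fun c => ξ' c * f c g]
      simp_rw [hξ']
    · rw [Real.coe_toNNReal _ (mul_nonneg (sq_nonneg _) (perturbationVariance_nonneg _)), mul_pow,
        mul_assoc]
      refine mul_le_mul_of_nonneg_left ?_ (sq_nonneg _)
      refine le_trans ?_ (le_perturbationVariance _ hPQ (hW ξ' hsupp))
      refine le_trans (le_of_eq ?_) (hσW ξ' hsupp)
      rw [← Finset.sum_coe_sort s fun c => ξ' c ^ 2]
      simp_rw [hξ']

/-- The laws of the combinations of linear functions `f_c`, `c ∈ s`, of the perturbation. The factor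
`2` in the variance bound is there because `W` need not be symmetric and both `(a, b)` and `(b, a)`
contribute to the same entry. -/
lemma exists_map_perturbationLaw_eq_gaussianReal
    (hfW : ∀ ξ : κ → ℝ, (∀ c ∉ s, ξ c = 0) → ∀ g, ∑ c ∈ s, ξ c * f c g =
      ∑ i, ∑ a, ∑ b, W ξ i a b * perturbation g i a b)
    (hσW : ∀ ξ : κ → ℝ, (∀ c ∉ s, ξ c = 0) →
      2 * ∑ i, ∑ a, ∑ b, W ξ i a b ^ 2 ≤ σ ^ 2 * ∑ c ∈ s, ξ c ^ 2) (ξ : s → ℝ) :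
    ∃ v : ℝ≥0, (perturbationLaw n k ρ).map (fun g => ∑ c, ξ c * f c g) = gaussianReal 0 v ∧
      v ≤ (ρ * σ) ^ 2 * ∑ c, ξ c ^ 2 := by
  let ξ' : κ → ℝ := fun c => if h : c ∈ s then ξ ⟨c, h⟩ else 0
  have hξ' : ∀ c : s, ξ c = ξ' c := fun c => by simp [ξ']
  have hsupp : ∀ c ∉ s, ξ' c = 0 := fun c hc => by simp [ξ', hc]
  refine ⟨Real.toNNReal (ρ ^ 2 * perturbationVariance (W ξ')), ?_, ?_⟩
  · rw [← map_perturbationLaw_functional]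
    congr 1
    funext g
    rw [zero_add, ← hfW ξ' hsupp, ← Finset.sum_coe_sort s fun c => ξ' c * f c g]
    simp_rw [hξ']
  · rw [Real.coe_toNNReal _ (mul_nonneg (sq_nonneg _) (perturbationVariance_nonneg _)), mul_pow,
      mul_assoc]
    refine mul_le_mul_of_nonneg_left ?_ (sq_nonneg _)
    refine (perturbationVariance_le _).trans ((hσW ξ' hsupp).trans (le_of_eq ?_))
    rw [← Finset.sum_coe_sort s fun c => ξ' c ^ 2]
    simp_rw [hξ']

lemma perturbationLaw_le_sum_sq_le (hf : ∀ c, Measurable (f c)) (hρ : 0 < ρ) (hσ : 0 < σ) (t : ℝ)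
    (hfW : ∀ ξ : κ → ℝ, (∀ c ∉ s, ξ c = 0) → ∀ g, ∑ c ∈ s, ξ c * f c g =
      ∑ i, ∑ a, ∑ b, W ξ i a b * perturbation g i a b)
    (hσW : ∀ ξ : κ → ℝ, (∀ c ∉ s, ξ c = 0) →
      2 * ∑ i, ∑ a, ∑ b, W ξ i a b ^ 2 ≤ σ ^ 2 * ∑ c ∈ s, ξ c ^ 2) :
    (perturbationLaw n k ρ).real {g | t ≤ ∑ c ∈ s, f c g ^ 2} ≤
      Real.exp (-(t / (4 * (ρ * σ) ^ 2))) * √2 ^ s.card := by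
  have h := measureReal_le_sum_sq_le (μ := perturbationLaw n k ρ) (f := fun c : s => f c)
    (s := ρ * σ) (fun c => hf c) (mul_pos hρ hσ) t
    (exists_map_perturbationLaw_eq_gaussianReal hfW hσW)
  rw [Fintype.card_coe] at h
  exact (congrArg _ (Set.ext fun g => by
    simp only [Set.mem_ofPred_eq, Finset.sum_coe_sort s fun c => f c g ^ 2])).trans_le h

lemma perturbationLaw_sq_mul_card_le_sum_sq_le (hf : ∀ c, Measurable (f c)) (hρ : 0 < ρ)
    (hσ : 0 < σ) {K : ℝ} (hK : 0 < K)
    (hfW : ∀ ξ : κ → ℝ, (∀ c ∉ s, ξ c = 0) → ∀ g, ∑ c ∈ s, ξ c * f c g =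
      ∑ i, ∑ a, ∑ b, W ξ i a b * perturbation g i a b)
    (hσW : ∀ ξ : κ → ℝ, (∀ c ∉ s, ξ c = 0) →
      2 * ∑ i, ∑ a, ∑ b, W ξ i a b ^ 2 ≤ σ ^ 2 * ∑ c ∈ s, ξ c ^ 2) :
    (perturbationLaw n k ρ).real {g | K ^ 2 * (ρ * σ) ^ 2 * s.card ≤ ∑ c ∈ s, f c g ^ 2} ≤
      (2 / K) ^ s.card := by
  have h := measureReal_sq_mul_card_le_sum_sq_le (μ := perturbationLaw n k ρ)
    (f := fun c : s => f c) (s := ρ * σ) (fun c => hf c) (mul_pos hρ hσ) hK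
    (exists_map_perturbationLaw_eq_gaussianReal hfW hσW)
  rw [Fintype.card_coe] at h
  exact (congrArg _ (Set.ext fun g => by
    simp only [Set.mem_ofPred_eq, Finset.sum_coe_sort s fun c => f c g ^ 2])).trans_le h

end Families

end Perturbation

/-! ### The block maps built from the covariance entries -/

section BlockMaps

variable {n k : ℕ}

/-- Coefficients on the covariance columns `Σ_i[:, j]`, `j ∈ H`, extended by zero to all columns. -/
def extendZero (H : Finset (Fin n)) :
    EuclideanSpace ℝ (Fin k × H) →ₗ[ℝ] (Fin k → Fin n → ℝ) where
  toFun v i a := if h : a ∈ H then v (i, ⟨a, h⟩) else 0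
  map_add' v w := by
    funext i a
    by_cases h : a ∈ H <;> simp [h]
  map_smul' c v := by
    funext i a
    by_cases h : a ∈ H <;> simp [h]

lemma extendZero_of_notMem {H : Finset (Fin n)} (v : EuclideanSpace ℝ (Fin k × H)) (i : Fin k)
    {a : Fin n} (ha : a ∉ H) : extendZero H v i a = 0 := by
  simp [extendZero, ha]

lemma extendZero_apply_coe {H : Finset (Fin n)} (v : EuclideanSpace ℝ (Fin k × H)) (i : Fin k)
    (a : H) : extendZero H v i a = v (i, a) := by
  simp [extendZero]

lemma sum_mul_extendZero {H : Finset (Fin n)} (v : EuclideanSpace ℝ (Fin k × H))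
    (y : Fin k → Fin n → ℝ) :
    ∑ i, ∑ a, extendZero H v i a * y i a = ∑ c : Fin k × H, v c * y c.1 c.2 := by
  rw [Fintype.sum_prod_type]
  refine Finset.sum_congr rfl fun i _ => ?_
  rw [← Finset.sum_subset (Finset.subset_univ H) fun a _ ha => by
    rw [extendZero_of_notMem v i ha, zero_mul],
    ← Finset.sum_coe_sort H fun a => extendZero H v i a * y i a]
  simp_rw [extendZero_apply_coe]

lemma norm_sq_eq_sum_extendZero {H : Finset (Fin n)} (v : EuclideanSpace ℝ (Fin k × H)) :
    ‖v‖ ^ 2 = ∑ i, ∑ a, extendZero H v i a ^ 2 := by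
  rw [EuclideanSpace.real_norm_sq_eq]
  simp_rw [pow_two]
  rw [sum_mul_extendZero]
  simp_rw [extendZero_apply_coe]

lemma norm_sq_eq_sum_mem_extendZero {H : Finset (Fin n)} (v : EuclideanSpace ℝ (Fin k × H)) :
    ‖v‖ ^ 2 = ∑ a ∈ H, ∑ i, extendZero H v i a ^ 2 := by
  rw [norm_sq_eq_sum_extendZero, Finset.sum_comm]
  refine (Finset.sum_subset (Finset.subset_univ H) fun a _ ha => ?_).symm
  simp_rw [extendZero_of_notMem v _ ha]
  simp

/-- The linear combinations of the columns `x_i[:, j]`, `j ∈ H`, restricted to the rows in `R`. -/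
def rowMap (x : Fin k → Matrix (Fin n) (Fin n) ℝ) (R H : Finset (Fin n)) :
    EuclideanSpace ℝ (Fin k × H) →ₗ[ℝ] EuclideanSpace ℝ R where
  toFun v := WithLp.toLp 2 fun r => ∑ i, ∑ a, extendZero H v i a * x i r a
  map_add' v w := by
    ext r
    simp [add_mul, Finset.sum_add_distrib]
  map_smul' c v := by
    ext r
    simp [mul_assoc, Finset.mul_sum]

lemma rowMap_apply (x : Fin k → Matrix (Fin n) (Fin n) ℝ) (R H : Finset (Fin n))
    (v : EuclideanSpace ℝ (Fin k × H)) (r : R) :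
    rowMap x R H v r = ∑ i, ∑ a, extendZero H v i a * x i r a := rfl

lemma rowMap_add (x y : Fin k → Matrix (Fin n) (Fin n) ℝ) (R H : Finset (Fin n)) :
    rowMap (x + y) R H = rowMap x R H + rowMap y R H := by
  ext v r
  simp [rowMap_apply, mul_add, Finset.sum_add_distrib]

lemma norm_sq_rowMap (x : Fin k → Matrix (Fin n) (Fin n) ℝ) (R H : Finset (Fin n))
    (v : EuclideanSpace ℝ (Fin k × H)) :
    ‖rowMap x R H v‖ ^ 2 = ∑ r ∈ R, (∑ i, ∑ a, extendZero H v i a * x i r a) ^ 2 := by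
  rw [EuclideanSpace.real_norm_sq_eq,
    ← Finset.sum_coe_sort R fun r => (∑ i, ∑ a, extendZero H v i a * x i r a) ^ 2]
  rfl

/-- The entry at `(p, q, r)` of the tensor
`∑_i (v_{i,·} ⊗ x_i + …)`, with the vector placed in each of the three modes in turn. -/
def tensorEntry (x : Fin k → Matrix (Fin n) (Fin n) ℝ) (v : Fin k → Fin n → ℝ) (p q r : Fin n) : ℝ :=
  ∑ i, (v i p * x i q r + v i q * x i p r + v i r * x i p q)

/-- The transposed coefficient matrix of the moment slices: column `(p, q, r)` of the slice
matrix has weighted coefficients `x_i[p, q]` on `Σ_i[:, r]`, `x_i[p, r]` on `Σ_i[:, q]` and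
`x_i[q, r]` on `Σ_i[:, p]`. -/
def tensorMap (x : Fin k → Matrix (Fin n) (Fin n) ℝ) (H H₁ H₂ H₃ : Finset (Fin n)) :
    EuclideanSpace ℝ (Fin k × H) →ₗ[ℝ] EuclideanSpace ℝ (H₁ × H₂ × H₃) where
  toFun v := WithLp.toLp 2 fun c => tensorEntry x (extendZero H v) c.1 c.2.1 c.2.2
  map_add' v w := by
    ext c
    simp only [tensorEntry, map_add, Pi.add_apply, PiLp.add_apply, ← Finset.sum_add_distrib]
    exact Finset.sum_congr rfl fun i _ => by ring
  map_smul' t v := by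
    ext c
    simp only [tensorEntry, map_smul, Pi.smul_apply, smul_eq_mul, PiLp.smul_apply, RingHom.id_apply,
      Finset.mul_sum]
    exact Finset.sum_congr rfl fun i _ => by ring

lemma tensorMap_apply (x : Fin k → Matrix (Fin n) (Fin n) ℝ) (H H₁ H₂ H₃ : Finset (Fin n))
    (v : EuclideanSpace ℝ (Fin k × H)) (c : H₁ × H₂ × H₃) :
    tensorMap x H H₁ H₂ H₃ v c = tensorEntry x (extendZero H v) c.1 c.2.1 c.2.2 := rfl

lemma tensorMap_add (x y : Fin k → Matrix (Fin n) (Fin n) ℝ) (H H₁ H₂ H₃ : Finset (Fin n)) :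
    tensorMap (x + y) H H₁ H₂ H₃ = tensorMap x H H₁ H₂ H₃ + tensorMap y H H₁ H₂ H₃ := by
  ext v c
  simp only [tensorMap_apply, tensorEntry, Pi.add_apply, Matrix.add_apply, LinearMap.add_apply,
    PiLp.add_apply, ← Finset.sum_add_distrib]
  exact Finset.sum_congr rfl fun i _ => by ring

lemma norm_sq_tensorMap (x : Fin k → Matrix (Fin n) (Fin n) ℝ) (H H₁ H₂ H₃ : Finset (Fin n))
    (v : EuclideanSpace ℝ (Fin k × H)) :
    ‖tensorMap x H H₁ H₂ H₃ v‖ ^ 2 =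
      ∑ p ∈ H₁, ∑ q ∈ H₂, ∑ r ∈ H₃, tensorEntry x (extendZero H v) p q r ^ 2 := by
  rw [EuclideanSpace.real_norm_sq_eq, Fintype.sum_prod_type, ← Finset.sum_coe_sort H₁]
  refine Finset.sum_congr rfl fun p _ => ?_
  rw [Fintype.sum_prod_type, ← Finset.sum_coe_sort H₂]
  refine Finset.sum_congr rfl fun q _ => ?_
  rw [← Finset.sum_coe_sort H₃]
  rfl

end BlockMaps

/-! ### Tail bounds for the entries of the block maps -/

section BlockTails

variable {n k : ℕ} {ρ ε : ℝ}

lemma sum_mem_mul_eq_sum_univ {κ : Type*} [Fintype κ] {s : Finset κ} {ξ : κ → ℝ}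
    (hξ : ∀ c ∉ s, ξ c = 0) (f : κ → ℝ) : ∑ c ∈ s, ξ c * f c = ∑ c, ξ c * f c :=
  Finset.sum_subset (Finset.subset_univ s) fun c _ hc => by rw [hξ c hc, zero_mul]

lemma sum_sq_mem_eq_sum_univ {κ : Type*} [Fintype κ] {s : Finset κ} {ξ : κ → ℝ}
    (hξ : ∀ c ∉ s, ξ c = 0) : ∑ c ∈ s, ξ c ^ 2 = ∑ c, ξ c ^ 2 :=
  Finset.sum_subset (Finset.subset_univ s) fun c _ hc => by rw [hξ c hc, zero_pow two_ne_zero]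

lemma sum_mul_row_eq (ξ : Fin n → ℝ) (v : Fin k → Fin n → ℝ)
    (y : Fin k → Matrix (Fin n) (Fin n) ℝ) :
    ∑ r, ξ r * ∑ i, ∑ a, v i a * y i r a = ∑ i, ∑ a, ∑ b, (ξ a * v i b) * y i a b := by
  simp_rw [Finset.mul_sum]
  rw [Finset.sum_comm]
  refine Finset.sum_congr rfl fun i _ => Finset.sum_congr rfl fun r _ =>
    Finset.sum_congr rfl fun a _ => by ring

lemma sum_sq_mul_eq (ξ : Fin n → ℝ) (v : Fin k → Fin n → ℝ) (P Q : Finset (Fin n)) :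
    ∑ i, ∑ a ∈ P, ∑ b ∈ Q, (ξ a * v i b) ^ 2 =
      (∑ i, ∑ b ∈ Q, v i b ^ 2) * ∑ a ∈ P, ξ a ^ 2 := by
  rw [Finset.sum_mul]
  refine Finset.sum_congr rfl fun i _ => ?_
  rw [Finset.sum_mul, Finset.sum_comm]
  refine Finset.sum_congr rfl fun b _ => ?_
  rw [Finset.mul_sum]
  exact Finset.sum_congr rfl fun a _ => by ring

lemma row_variance_le {R : Finset (Fin n)} {v : Fin k → Fin n → ℝ} {σ : ℝ}
    (hv : 2 * ∑ i, ∑ a, v i a ^ 2 ≤ σ ^ 2) (ξ : Fin n → ℝ) (hξ : ∀ c ∉ R, ξ c = 0) :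
    2 * ∑ i, ∑ a, ∑ b, (ξ a * v i b) ^ 2 ≤ σ ^ 2 * ∑ c ∈ R, ξ c ^ 2 := by
  rw [sum_sq_mul_eq, sum_sq_mem_eq_sum_univ hξ, ← mul_assoc]
  exact mul_le_mul_of_nonneg_right hv (Finset.sum_nonneg fun _ _ => sq_nonneg _)

lemma perturbationLaw_row_sq_ge_le (hρ : 0 < ρ) {K : ℝ} (hK : 0 < K) (R : Finset (Fin n))
    {v : Fin k → Fin n → ℝ} (hv : ∑ i, ∑ a, v i a ^ 2 ≤ 1) :
    (perturbationLaw n k ρ).real {g | K ^ 2 * (ρ * 2) ^ 2 * R.card ≤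
      ∑ r ∈ R, (∑ i, ∑ a, v i a * perturbation g i r a) ^ 2} ≤ (2 / K) ^ R.card :=
  perturbationLaw_sq_mul_card_le_sum_sq_le
    (f := fun r g => ∑ i, ∑ a, v i a * perturbation g i r a)
    (W := fun ξ i a b => ξ a * v i b)
    (fun r => by fun_prop) hρ two_pos hK
    (fun ξ hξ g => by rw [sum_mem_mul_eq_sum_univ hξ, sum_mul_row_eq])
    (row_variance_le (by linarith))

lemma perturbationLaw_row_ge_le (hρ : 0 < ρ) (t : ℝ) (R : Finset (Fin n))
    {v : Fin k → Fin n → ℝ} (hv : ∑ i, ∑ a, v i a ^ 2 ≤ 1) :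
    (perturbationLaw n k ρ).real {g | t ≤
      ∑ r ∈ R, (∑ i, ∑ a, v i a * perturbation g i r a) ^ 2} ≤
        Real.exp (-(t / (4 * (ρ * 2) ^ 2))) * √2 ^ R.card :=
  perturbationLaw_le_sum_sq_le
    (f := fun r g => ∑ i, ∑ a, v i a * perturbation g i r a)
    (W := fun ξ i a b => ξ a * v i b)
    (fun r => by fun_prop) hρ two_pos t
    (fun ξ hξ g => by rw [sum_mem_mul_eq_sum_univ hξ, sum_mul_row_eq])
    (row_variance_le (by linarith))

/-- Small ball bound for the rows `R` of a fixed combination of the columns in `H`. As `R` and `H`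
are disjoint, each entry is used in one row only. -/
lemma perturbationLaw_row_sq_le_le (hρ : 0 < ρ) (hε : 0 < ε) {H R : Finset (Fin n)}
    (hHR : Disjoint R H) (x : Fin k → Matrix (Fin n) (Fin n) ℝ) {v : Fin k → Fin n → ℝ} {σ : ℝ}
    (hσ : 0 < σ) (hv : σ ^ 2 = ∑ i, ∑ a ∈ H, v i a ^ 2) :
    (perturbationLaw n k ρ).real {g |
      ∑ r ∈ R, (∑ i, ∑ a, v i a * (x i r a + perturbation g i r a)) ^ 2 ≤
        ε ^ 2 * (ρ * σ) ^ 2 * R.card} ≤ (2 * ε) ^ R.card :=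
  perturbationLaw_sum_sq_le_le
    (f := fun r g => ∑ i, ∑ a, v i a * (x i r a + perturbation g i r a))
    (W := fun ξ i a b => ξ a * v i b)
    (fun r => by fun_prop) hρ hσ hε (fun ξ => ∑ i, ∑ a, ∑ b, (ξ a * v i b) * x i a b) hHR
    (fun ξ hξ g => by
      rw [sum_mem_mul_eq_sum_univ hξ, ← sum_mul_row_eq, ← sum_mul_row_eq,
        ← Finset.sum_add_distrib]
      refine Finset.sum_congr rfl fun r _ => ?_
      simp_rw [mul_add, Finset.sum_add_distrib]
      rw [mul_add])
    (fun ξ hξ i a _ b hb => by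
      rw [hξ b (Finset.disjoint_right.mp hHR hb), zero_mul])
    (fun ξ hξ => by rw [sum_sq_mul_eq, hv])

lemma perturbationLaw_block_sq_ge_le (hρ : 0 < ρ) {K : ℝ} (hK : 0 < K) (P Q : Finset (Fin n))
    {w : Fin k → ℝ} (hw : ∑ i, w i ^ 2 ≤ 1) :
    (perturbationLaw n k ρ).real {g | K ^ 2 * (ρ * 2) ^ 2 * (P ×ˢ Q).card ≤
      ∑ c ∈ P ×ˢ Q, (∑ i, w i * perturbation g i c.1 c.2) ^ 2} ≤ (2 / K) ^ (P ×ˢ Q).card :=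
  perturbationLaw_sq_mul_card_le_sum_sq_le
    (f := fun c g => ∑ i, w i * perturbation g i c.1 c.2)
    (W := fun ξ i a b => ξ (a, b) * w i)
    (fun r => by fun_prop) hρ two_pos hK
    (fun ξ hξ g => by
      rw [sum_mem_mul_eq_sum_univ hξ]
      simp_rw [Finset.mul_sum]
      rw [Finset.sum_comm]
      simp_rw [Fintype.sum_prod_type, mul_assoc])
    (fun ξ hξ => by
      have h : ∑ i, ∑ a, ∑ b, (ξ (a, b) * w i) ^ 2 = (∑ i, w i ^ 2) * ∑ c, ξ c ^ 2 := by
        rw [Finset.sum_mul]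
        refine Finset.sum_congr rfl fun i _ => ?_
        rw [Fintype.sum_prod_type, Finset.mul_sum]
        refine Finset.sum_congr rfl fun a _ => ?_
        rw [Finset.mul_sum]
        exact Finset.sum_congr rfl fun b _ => by ring
      rw [sum_sq_mem_eq_sum_univ hξ, h, ← mul_assoc]
      exact mul_le_mul_of_nonneg_right (by linarith) (Finset.sum_nonneg fun _ _ => sq_nonneg _))

/-- Small ball bound for one slice of the tensor `∑_i (v_{i,·} ⊗ x_i + …)`. With `j` the index of the
slice, only the summands `w_i x_i[p, q]` are used; they are independent over `(p, q) ∈ P × Q`, also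
of the other two kinds of summands. -/
lemma perturbationLaw_slice_sq_le_le (hρ : 0 < ρ) (hε : 0 < ε) {j : Fin n} {P Q : Finset (Fin n)}
    (hPQ : Disjoint P Q) (hjP : j ∉ P) (hjQ : j ∉ Q) (x : Fin k → Matrix (Fin n) (Fin n) ℝ)
    {w : Fin k → ℝ} (α β : Fin k → Fin n → ℝ) {σ : ℝ} (hσ : 0 < σ) (hw : σ ^ 2 = ∑ i, w i ^ 2) :
    (perturbationLaw n k ρ).real {g |
      ∑ c ∈ P ×ˢ Q, (∑ i, (w i * (x i c.1 c.2 + perturbation g i c.1 c.2) +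
        α i c.1 * (x i j c.2 + perturbation g i j c.2) +
        β i c.2 * (x i j c.1 + perturbation g i j c.1))) ^ 2 ≤
        ε ^ 2 * (ρ * σ) ^ 2 * (P ×ˢ Q).card} ≤ (2 * ε) ^ (P ×ˢ Q).card := by
  let W : (Fin n × Fin n → ℝ) → Fin k → Fin n → Fin n → ℝ := fun ξ i a b =>
    ξ (a, b) * w i + if a = j then ∑ p, ξ (p, b) * α i p + ∑ q, ξ (b, q) * β i q else 0
  -- the functional is bilinear in `ξ` and the matrices, with coefficients `W`
  have hlin : ∀ (ξ : Fin n × Fin n → ℝ) (y : Fin k → Matrix (Fin n) (Fin n) ℝ),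
      ∑ c, ξ c * ∑ i, (w i * y i c.1 c.2 + α i c.1 * y i j c.2 + β i c.2 * y i j c.1) =
        ∑ i, ∑ a, ∑ b, W ξ i a b * y i a b := by
    intro ξ y
    simp_rw [Finset.mul_sum]
    rw [Finset.sum_comm]
    refine Finset.sum_congr rfl fun i _ => ?_
    have h1 : ∑ a, ∑ b, W ξ i a b * y i a b = ∑ a, ∑ b, ξ (a, b) * w i * y i a b +
        ∑ b, (∑ p, ξ (p, b) * α i p + ∑ q, ξ (b, q) * β i q) * y i j b := by
      simp only [W, add_mul, Finset.sum_add_distrib, ite_mul, zero_mul]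
      congr 1
      rw [Finset.sum_comm]
      simp [Finset.sum_add_distrib]
    rw [h1]
    simp_rw [add_mul, Finset.sum_add_distrib, Finset.sum_mul]
    rw [Fintype.sum_prod_type, Finset.sum_comm (f := fun b p => ξ (p, b) * α i p * y i j b)]
    simp_rw [← Finset.sum_add_distrib]
    exact Finset.sum_congr rfl fun p _ => Finset.sum_congr rfl fun q _ => by ring
  refine perturbationLaw_sum_sq_le_le
    (f := fun (c : Fin n × Fin n) g => ∑ i, (w i * (x i c.1 c.2 + perturbation g i c.1 c.2) +
        α i c.1 * (x i j c.2 + perturbation g i j c.2) +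
        β i c.2 * (x i j c.1 + perturbation g i j c.1)))
    (W := W) (fun c => by fun_prop) hρ hσ hε (fun ξ => ∑ i, ∑ a, ∑ b, W ξ i a b * x i a b) hPQ
    (fun ξ hξ g => ?_) (fun ξ hξ i a ha b hb => ?_) (fun ξ hξ => ?_)
  · rw [sum_mem_mul_eq_sum_univ hξ]
    have h := hlin ξ fun i => x i + perturbation g i
    simp only [Matrix.add_apply] at h
    rw [h]
    simp_rw [mul_add, Finset.sum_add_distrib]
  · have hbj : b ≠ j := fun h => hjQ (h ▸ hb)
    have hba : (b, a) ∉ P ×ˢ Q := fun h =>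
      Finset.disjoint_left.mp hPQ (Finset.mem_product.mp h).1 hb
    simp [W, hbj, hξ _ hba]
  · rw [hw, Finset.sum_mul]
    refine Finset.sum_le_sum fun i _ => le_of_eq ?_
    rw [Finset.sum_product, Finset.mul_sum]
    refine Finset.sum_congr rfl fun a ha => ?_
    rw [Finset.mul_sum]
    refine Finset.sum_congr rfl fun b _ => ?_
    have haj : a ≠ j := fun h => hjP (h ▸ ha)
    simp only [W, if_neg haj]
    ring

end BlockTails

/-! ### Least singular values of the block maps -/

section BlockEvents

variable {n k : ℕ} {ρ ε : ℝ}

@[fun_prop]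
lemma measurable_norm_rowMap (x : Fin k → Matrix (Fin n) (Fin n) ℝ) (R H : Finset (Fin n))
    (v : EuclideanSpace ℝ (Fin k × H)) :
    Measurable fun g => ‖rowMap (x + perturbation g) R H v‖ := by
  have h : ∀ g, ‖rowMap (x + perturbation g) R H v‖ =
      √(∑ r ∈ R, (∑ i, ∑ a, extendZero H v i a * (x i r a + perturbation g i r a)) ^ 2) := by
    intro g
    rw [← Real.sqrt_sq (norm_nonneg (rowMap (x + perturbation g) R H v)), norm_sq_rowMap]
    rfl
  simp_rw [h]
  fun_prop

@[fun_prop]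
lemma measurable_norm_tensorMap (x : Fin k → Matrix (Fin n) (Fin n) ℝ)
    (H H₁ H₂ H₃ : Finset (Fin n)) (v : EuclideanSpace ℝ (Fin k × H)) :
    Measurable fun g => ‖tensorMap (x + perturbation g) H H₁ H₂ H₃ v‖ := by
  have h : ∀ g, ‖tensorMap (x + perturbation g) H H₁ H₂ H₃ v‖ =
      √(∑ p ∈ H₁, ∑ q ∈ H₂, ∑ r ∈ H₃, (∑ i, (extendZero H v i p * (x i q r + perturbation g i q r) +
        extendZero H v i q * (x i p r + perturbation g i p r) +
        extendZero H v i r * (x i p q + perturbation g i p q))) ^ 2) := by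
    intro g
    rw [← Real.sqrt_sq (norm_nonneg (tensorMap (x + perturbation g) H H₁ H₂ H₃ v)),
      norm_sq_tensorMap]
    rfl
  simp_rw [h]
  fun_prop

/-- Tail bound for the operator norm of the perturbation of a set of rows. -/
lemma exists_event_norm_rowMap_perturbation_le (hρ : 0 < ρ) (hε : 0 < ε) (R H : Finset (Fin n)) :
    ∃ E : Set (UpperEntries n k), MeasurableSet E ∧
      (perturbationLaw n k ρ).real Eᶜ ≤ 6 ^ (k * H.card) * (2 * ε) ^ R.card ∧
      ∀ g ∈ E, ∀ v, ‖rowMap (perturbation g) R H v‖ ≤ 4 * ρ * √R.card / ε * ‖v‖ := by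
  obtain ⟨E, hE, hEp, hEv⟩ := exists_event_norm_apply_le (μ := perturbationLaw n k ρ)
    (fun g => rowMap (perturbation g) R H) (τ := 2 * ρ * √R.card / ε) (p := (2 * ε) ^ R.card)
    (fun v => by simpa using measurable_norm_rowMap 0 R H v) (fun v hv => by
      have h1 : ∑ i, ∑ a, extendZero H v i a ^ 2 ≤ 1 := by
        rw [← norm_sq_eq_sum_extendZero]
        exact pow_le_one₀ (norm_nonneg _) hv
      have h := perturbationLaw_row_sq_ge_le hρ (inv_pos.mpr hε) R h1
      rw [div_inv_eq_mul] at h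
      refine (measureReal_mono fun g hg => ?_).trans h
      have hg' : 2 * ρ * √R.card / ε ≤ ‖rowMap (perturbation g) R H v‖ := hg
      have h2 := pow_le_pow_left₀ (by positivity) hg' 2
      rw [norm_sq_rowMap] at h2
      refine le_trans (le_of_eq ?_) h2
      rw [div_pow, mul_pow _ (√_), Real.sq_sqrt (Nat.cast_nonneg _)]
      field_simp)
  refine ⟨E, hE, ?_, fun g hg v => ?_⟩
  · rw [finrank_euclideanSpace, Fintype.card_prod, Fintype.card_fin, Fintype.card_coe] at hEp
    exact hEp
  · refine (hEv g hg v).trans (le_of_eq ?_)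
    ring

/-- The columns `x_i[:, j] + Δ_i[:, j]`, `j ∈ H`, restricted to the rows in `R`, are well
conditioned. The rows must avoid `H` for their entries to be independent. -/
lemma exists_event_le_norm_rowMap (hρ : 0 < ρ) (hε : 0 < ε) (hε1 : ε ≤ 1) {R H : Finset (Fin n)}
    (hRH : Disjoint R H) (hR : R.Nonempty) (x : Fin k → Matrix (Fin n) (Fin n) ℝ) :
    ∃ E : Set (UpperEntries n k), MeasurableSet E ∧
      (perturbationLaw n k ρ).real Eᶜ ≤
        (6 ^ (k * H.card) + (864 / ε ^ 2) ^ (k * H.card)) * (2 * ε) ^ R.card ∧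
      ∀ g ∈ E, ∀ v, ε * ρ * √R.card / 4 * ‖v‖ ≤ ‖rowMap (x + perturbation g) R H v‖ := by
  obtain ⟨E₁, hE₁, hE₁p, hE₁v⟩ :=
    exists_event_norm_rowMap_perturbation_le (k := k) hρ hε R H
  have hN : 0 < √(R.card : ℝ) := Real.sqrt_pos.mpr (by exact_mod_cast hR.card_pos)
  have hε2 : ε ^ 2 ≤ 1 := pow_le_one₀ hε.le hε1
  have hκ : 0 < 4 * ρ * √R.card / ε := by positivity
  have hβκ : ε * ρ * √R.card ≤ 4 * (4 * ρ * √R.card / ε) := by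
    rw [← mul_div_assoc, le_div_iff₀ hε]
    nlinarith [mul_pos hρ hN]
  have hδκ : 12 * (4 * ρ * √R.card / ε) * (ε ^ 2 / 288) ≤ ε * ρ * √R.card := by
    have h : 12 * (4 * ρ * √R.card / ε) * (ε ^ 2 / 288) = ε * ρ * √R.card / 6 := by
      field_simp; norm_num
    rw [h]
    have : 0 < ε * ρ * √R.card := by positivity
    linarith
  -- `κ / β` is of order `ε⁻²`, hence the mesh of the net
  obtain ⟨E₂, hE₂, hE₂p, hE₂v⟩ := exists_event_le_norm_add_apply (μ := perturbationLaw n k ρ)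
    (rowMap x R H) (fun g => rowMap (perturbation g) R H) (κ := 4 * ρ * √R.card / ε)
    (β := ε * ρ * √R.card) (δ := ε ^ 2 / 288) (p := (2 * ε) ^ R.card)
    (fun v => by simpa only [← rowMap_add] using measurable_norm_rowMap x R H v) hκ (by positivity)
    (by positivity) (by linarith) hβκ hδκ (by positivity) (fun v hv => by
      have hv' : 0 < ‖v‖ := norm_pos_iff.mpr hv
      have h := perturbationLaw_row_sq_le_le hρ hε hRH x (v := extendZero H v) hv' (by
        rw [norm_sq_eq_sum_mem_extendZero, Finset.sum_comm])
      refine (measureReal_mono fun g hg => ?_).trans h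
      have hg' : ‖(rowMap x R H + rowMap (perturbation g) R H) v‖ ≤ ε * ρ * √R.card * ‖v‖ := hg
      rw [← rowMap_add] at hg'
      have h2 := pow_le_pow_left₀ (norm_nonneg _) hg' 2
      rw [norm_sq_rowMap] at h2
      refine le_trans h2 (le_of_eq ?_)
      rw [mul_pow, mul_pow, Real.sq_sqrt (Nat.cast_nonneg _)]
      ring)
  refine ⟨E₁ ∩ E₂, hE₁.inter hE₂, ?_, fun g hg v => ?_⟩
  · rw [Set.compl_inter, add_mul]
    refine (measureReal_union_le _ _).trans (add_le_add hE₁p (hE₂p.trans (le_of_eq ?_)))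
    rw [finrank_euclideanSpace, Fintype.card_prod, Fintype.card_fin, Fintype.card_coe]
    congr 2
    field_simp
    norm_num
  · rw [rowMap_add]
    exact hE₂v g hg.2 (hE₁v g hg.1) v

/-- Tail bound for the operator norm of the perturbation of the `P × Q` blocks, as a map of the
combination coefficients. -/
lemma exists_event_block_le (hρ : 0 < ρ) (hε : 0 < ε) (P Q : Finset (Fin n)) :
    ∃ E : Set (UpperEntries n k), MeasurableSet E ∧
      (perturbationLaw n k ρ).real Eᶜ ≤ 6 ^ k * (2 * ε) ^ (P ×ˢ Q).card ∧
      ∀ g ∈ E, ∀ w : Fin k → ℝ, ∑ p ∈ P, ∑ q ∈ Q, (∑ i, w i * perturbation g i p q) ^ 2 ≤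
        (4 * ρ / ε) ^ 2 * (P ×ˢ Q).card * ∑ i, w i ^ 2 := by
  let G : UpperEntries n k → EuclideanSpace ℝ (Fin k) →ₗ[ℝ] EuclideanSpace ℝ (P ×ˢ Q : Finset _) :=
    fun g =>
      { toFun := fun w => WithLp.toLp 2 fun c => ∑ i, w i * perturbation g i c.1.1 c.1.2
        map_add' := fun w w' => by
          ext c; simp [add_mul, Finset.sum_add_distrib]
        map_smul' := fun t w => by
          ext c; simp [mul_assoc, Finset.mul_sum] }
  have hG : ∀ g w, ‖G g w‖ ^ 2 = ∑ c ∈ P ×ˢ Q, (∑ i, w i * perturbation g i c.1 c.2) ^ 2 := by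
    intro g w
    rw [EuclideanSpace.real_norm_sq_eq,
      ← Finset.sum_coe_sort (P ×ˢ Q) fun c => (∑ i, w i * perturbation g i c.1 c.2) ^ 2]
    rfl
  obtain ⟨E, hE, hEp, hEv⟩ := exists_event_norm_apply_le (μ := perturbationLaw n k ρ)
    G (τ := 2 * ρ * √(P ×ˢ Q).card / ε) (p := (2 * ε) ^ (P ×ˢ Q).card)
    (fun w => by
      have h : ∀ g, ‖G g w‖ = √(∑ c ∈ P ×ˢ Q, (∑ i, w i * perturbation g i c.1 c.2) ^ 2) := by
        intro g
        rw [← hG, Real.sqrt_sq (norm_nonneg _)]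
      simp_rw [h]
      fun_prop) (fun w hw => by
      have h1 : ∑ i, w i ^ 2 ≤ 1 := by
        rw [← EuclideanSpace.real_norm_sq_eq]
        exact pow_le_one₀ (norm_nonneg _) hw
      have h := perturbationLaw_block_sq_ge_le hρ (inv_pos.mpr hε) P Q h1
      rw [div_inv_eq_mul] at h
      refine (measureReal_mono fun g hg => ?_).trans h
      have hg' : 2 * ρ * √(P ×ˢ Q).card / ε ≤ ‖G g w‖ := hg
      have h2 := pow_le_pow_left₀ (by positivity) hg' 2
      rw [hG] at h2
      refine le_trans (le_of_eq ?_) h2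
      rw [div_pow, mul_pow _ (√_), Real.sq_sqrt (Nat.cast_nonneg _)]
      field_simp)
  refine ⟨E, hE, ?_, fun g hg w => ?_⟩
  · rwa [finrank_euclideanSpace, Fintype.card_fin] at hEp
  · have h := pow_le_pow_left₀ (norm_nonneg _) (hEv g hg (WithLp.toLp 2 w)) 2
    rw [hG, mul_pow, EuclideanSpace.real_norm_sq_eq, Finset.sum_product] at h
    refine h.trans (le_of_eq ?_)
    simp only
    rw [mul_pow, div_pow, mul_pow _ (√_), Real.sq_sqrt (Nat.cast_nonneg _)]
    ring

/-- The part of the tensor in which the vector sits in a fixed mode is controlled by the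
operator norm of the complementary block. -/
lemma sum_mode_le {P Q R : Finset (Fin n)} {x : Fin k → Matrix (Fin n) (Fin n) ℝ} {c : ℝ}
    (hx : ∀ w : Fin k → ℝ, ∑ q ∈ Q, ∑ r ∈ R, (∑ i, w i * x i q r) ^ 2 ≤ c * ∑ i, w i ^ 2)
    (v : Fin k → Fin n → ℝ) :
    ∑ p ∈ P, ∑ q ∈ Q, ∑ r ∈ R, (∑ i, v i p * x i q r) ^ 2 ≤ c * ∑ p ∈ P, ∑ i, v i p ^ 2 := by
  rw [Finset.mul_sum]
  exact Finset.sum_le_sum fun p _ => hx fun i => v i p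

/-- The tensor is a sum of three terms, one for each mode, whose norms are controlled by the operator
norms of the three blocks. -/
lemma norm_sq_tensorMap_le {H H₁ H₂ H₃ : Finset (Fin n)} {x : Fin k → Matrix (Fin n) (Fin n) ℝ}
    (hH : ∀ φ : Fin n → ℝ, ∑ j ∈ H, φ j = ∑ j ∈ H₁, φ j + ∑ j ∈ H₂, φ j + ∑ j ∈ H₃, φ j) {c : ℝ}
    (h₁ : ∀ w : Fin k → ℝ, ∑ q ∈ H₂, ∑ r ∈ H₃, (∑ i, w i * x i q r) ^ 2 ≤ c * ∑ i, w i ^ 2)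
    (h₂ : ∀ w : Fin k → ℝ, ∑ q ∈ H₁, ∑ r ∈ H₃, (∑ i, w i * x i q r) ^ 2 ≤ c * ∑ i, w i ^ 2)
    (h₃ : ∀ w : Fin k → ℝ, ∑ q ∈ H₁, ∑ r ∈ H₂, (∑ i, w i * x i q r) ^ 2 ≤ c * ∑ i, w i ^ 2)
    (v : EuclideanSpace ℝ (Fin k × H)) :
    ‖tensorMap x H H₁ H₂ H₃ v‖ ^ 2 ≤ 3 * c * ‖v‖ ^ 2 := by
  set u := extendZero H v with hu
  have e1 := sum_mode_le (P := H₁) h₁ u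
  have e2 := sum_mode_le (P := H₂) h₂ u
  have e3 := sum_mode_le (P := H₃) h₃ u
  rw [Finset.sum_comm] at e2
  rw [Finset.sum_comm (s := H₃)] at e3
  simp_rw [Finset.sum_comm (s := H₃) (t := H₂)] at e3
  rw [norm_sq_tensorMap, norm_sq_eq_sum_mem_extendZero, hH, ← hu]
  have key : ∑ p ∈ H₁, ∑ q ∈ H₂, ∑ r ∈ H₃, tensorEntry x u p q r ^ 2 ≤
      3 * (∑ p ∈ H₁, ∑ q ∈ H₂, ∑ r ∈ H₃, (∑ i, u i p * x i q r) ^ 2 +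
        ∑ p ∈ H₁, ∑ q ∈ H₂, ∑ r ∈ H₃, (∑ i, u i q * x i p r) ^ 2 +
        ∑ p ∈ H₁, ∑ q ∈ H₂, ∑ r ∈ H₃, (∑ i, u i r * x i p q) ^ 2) := by
    simp_rw [← Finset.sum_add_distrib, Finset.mul_sum]
    refine Finset.sum_le_sum fun p _ => Finset.sum_le_sum fun q _ => Finset.sum_le_sum fun r _ => ?_
    simp only [tensorEntry, Finset.sum_add_distrib]
    set A := ∑ i, u i p * x i q r
    set B := ∑ i, u i q * x i p r
    set C := ∑ i, u i r * x i p q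
    nlinarith [sq_nonneg (A - B), sq_nonneg (A - C), sq_nonneg (B - C)]
  linarith

/-- If a tensor is small, then along a nonzero index of the vector its slice is small in
proportion, because the slices in the three modes carry three times its squared norm. -/
lemma exists_slice_le {H H₁ H₂ H₃ : Finset (Fin n)} {x : Fin k → Matrix (Fin n) (Fin n) ℝ}
    (hH : ∀ φ : Fin n → ℝ, ∑ j ∈ H, φ j = ∑ j ∈ H₁, φ j + ∑ j ∈ H₂, φ j + ∑ j ∈ H₃, φ j) {t : ℝ}
    {v : EuclideanSpace ℝ (Fin k × H)} (hv : v ≠ 0)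
    (hle : 3 * ‖tensorMap x H H₁ H₂ H₃ v‖ ^ 2 ≤ t * ‖v‖ ^ 2) :
    ∃ j, 0 < ∑ i, extendZero H v i j ^ 2 ∧
      ((j ∈ H₁ ∧ ∑ q ∈ H₂, ∑ r ∈ H₃, tensorEntry x (extendZero H v) j q r ^ 2 ≤
          t * ∑ i, extendZero H v i j ^ 2) ∨
        (j ∈ H₂ ∧ ∑ p ∈ H₁, ∑ r ∈ H₃, tensorEntry x (extendZero H v) p j r ^ 2 ≤
          t * ∑ i, extendZero H v i j ^ 2) ∨
        (j ∈ H₃ ∧ ∑ p ∈ H₁, ∑ q ∈ H₂, tensorEntry x (extendZero H v) p q j ^ 2 ≤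
          t * ∑ i, extendZero H v i j ^ 2)) := by
  by_contra! hcon
  set u := extendZero H v with hu
  have hsq : ∀ j, 0 ≤ ∑ i, u i j ^ 2 := fun j => Finset.sum_nonneg fun i _ => sq_nonneg _
  have hle' : ∀ (P : Finset (Fin n)) (Y : Fin n → ℝ), (∀ j, 0 ≤ Y j) →
      (∀ j ∈ P, 0 < ∑ i, u i j ^ 2 → t * ∑ i, u i j ^ 2 < Y j) →
      t * ∑ j ∈ P, ∑ i, u i j ^ 2 ≤ ∑ j ∈ P, Y j := by
    intro P Y hY0 hY
    rw [Finset.mul_sum]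
    refine Finset.sum_le_sum fun j hj => ?_
    rcases (hsq j).eq_or_lt with h0 | h0
    · rw [← h0, mul_zero]; exact hY0 j
    · exact (hY j hj h0).le
  have hlt : ∀ (P : Finset (Fin n)) (Y : Fin n → ℝ), (∀ j, 0 ≤ Y j) →
      (∀ j ∈ P, 0 < ∑ i, u i j ^ 2 → t * ∑ i, u i j ^ 2 < Y j) →
      0 < ∑ j ∈ P, ∑ i, u i j ^ 2 → t * ∑ j ∈ P, ∑ i, u i j ^ 2 < ∑ j ∈ P, Y j := by
    intro P Y hY0 hY hpos
    rw [Finset.mul_sum]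
    obtain ⟨j, hj, hj0⟩ : ∃ j ∈ P, 0 < ∑ i, u i j ^ 2 := by
      by_contra! h
      exact absurd (Finset.sum_nonpos h) (not_le.mpr hpos)
    refine Finset.sum_lt_sum (fun j hj => ?_) ⟨j, hj, hY j hj hj0⟩
    rcases (hsq j).eq_or_lt with h0 | h0
    · rw [← h0, mul_zero]; exact hY0 j
    · exact (hY j hj h0).le
  let Y₁ : Fin n → ℝ := fun j => ∑ q ∈ H₂, ∑ r ∈ H₃, tensorEntry x u j q r ^ 2
  let Y₂ : Fin n → ℝ := fun j => ∑ p ∈ H₁, ∑ r ∈ H₃, tensorEntry x u p j r ^ 2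
  let Y₃ : Fin n → ℝ := fun j => ∑ p ∈ H₁, ∑ q ∈ H₂, tensorEntry x u p q j ^ 2
  have n₁ : ∀ j, 0 ≤ Y₁ j := fun j =>
    Finset.sum_nonneg fun _ _ => Finset.sum_nonneg fun _ _ => sq_nonneg _
  have n₂ : ∀ j, 0 ≤ Y₂ j := fun j =>
    Finset.sum_nonneg fun _ _ => Finset.sum_nonneg fun _ _ => sq_nonneg _
  have n₃ : ∀ j, 0 ≤ Y₃ j := fun j =>
    Finset.sum_nonneg fun _ _ => Finset.sum_nonneg fun _ _ => sq_nonneg _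
  have c₁ : ∀ j ∈ H₁, 0 < ∑ i, u i j ^ 2 → t * ∑ i, u i j ^ 2 < Y₁ j :=
    fun j hj h0 => (hcon j h0).1 hj
  have c₂ : ∀ j ∈ H₂, 0 < ∑ i, u i j ^ 2 → t * ∑ i, u i j ^ 2 < Y₂ j :=
    fun j hj h0 => (hcon j h0).2.1 hj
  have c₃ : ∀ j ∈ H₃, 0 < ∑ i, u i j ^ 2 → t * ∑ i, u i j ^ 2 < Y₃ j :=
    fun j hj h0 => (hcon j h0).2.2 hj
  have s₁ : ∑ j ∈ H₁, Y₁ j = ‖tensorMap x H H₁ H₂ H₃ v‖ ^ 2 := by rw [norm_sq_tensorMap]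
  have s₂ : ∑ j ∈ H₂, Y₂ j = ‖tensorMap x H H₁ H₂ H₃ v‖ ^ 2 := by
    rw [norm_sq_tensorMap, Finset.sum_comm]
  have s₃ : ∑ j ∈ H₃, Y₃ j = ‖tensorMap x H H₁ H₂ H₃ v‖ ^ 2 := by
    rw [norm_sq_tensorMap, Finset.sum_comm]
    exact Finset.sum_congr rfl fun p _ => Finset.sum_comm
  have hv2 : 0 < ‖v‖ ^ 2 := by positivity
  have hnorm := norm_sq_eq_sum_mem_extendZero v
  rw [hH, ← hu] at hnorm
  have l₁ := hle' H₁ Y₁ n₁ c₁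
  have l₂ := hle' H₂ Y₂ n₂ c₂
  have l₃ := hle' H₃ Y₃ n₃ c₃
  have p₁ : 0 ≤ ∑ j ∈ H₁, ∑ i, u i j ^ 2 := Finset.sum_nonneg fun j _ => hsq j
  have p₂ : 0 ≤ ∑ j ∈ H₂, ∑ i, u i j ^ 2 := Finset.sum_nonneg fun j _ => hsq j
  have p₃ : 0 ≤ ∑ j ∈ H₃, ∑ i, u i j ^ 2 := Finset.sum_nonneg fun j _ => hsq j
  rw [hnorm] at hle hv2
  rcases p₁.eq_or_lt with z₁ | z₁
  · rcases p₂.eq_or_lt with z₂ | z₂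
    · have := hlt H₃ Y₃ n₃ c₃ (by linarith)
      linarith
    · have := hlt H₂ Y₂ n₂ c₂ z₂
      linarith
  · have := hlt H₁ Y₁ n₁ c₁ z₁
    linarith

/-- Small ball bound for the tensor of a fixed vector. -/
lemma perturbationLaw_norm_tensorMap_le_le (hρ : 0 < ρ) (hε : 0 < ε) {H H₁ H₂ H₃ : Finset (Fin n)}
    (hH : ∀ φ : Fin n → ℝ, ∑ j ∈ H, φ j = ∑ j ∈ H₁, φ j + ∑ j ∈ H₂, φ j + ∑ j ∈ H₃, φ j)
    (h₁₂ : Disjoint H₁ H₂) (h₁₃ : Disjoint H₁ H₃) (h₂₃ : Disjoint H₂ H₃) {m : ℕ}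
    (hm₁ : H₁.card = m) (hm₂ : H₂.card = m) (hm₃ : H₃.card = m)
    (x : Fin k → Matrix (Fin n) (Fin n) ℝ) (hx : ∀ i a b, x i a b = x i b a)
    {v : EuclideanSpace ℝ (Fin k × H)} (hv : v ≠ 0) :
    (perturbationLaw n k ρ).real {g | ‖tensorMap (x + perturbation g) H H₁ H₂ H₃ v‖ ≤
      ε * ρ * m / 2 * ‖v‖} ≤ 3 * m * (2 * ε) ^ (m ^ 2) := by
  set u := extendZero H v with hu
  let y : UpperEntries n k → Fin k → Matrix (Fin n) (Fin n) ℝ := fun g => x + perturbation g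
  have hy : ∀ g i a b, y g i a b = y g i b a := fun g i a b => by
    simp only [y, Pi.add_apply, Matrix.add_apply]
    rw [hx i a b, perturbation_comm]
  let B : Finset (Fin n) → Finset (Fin n) → Fin n → Set (UpperEntries n k) :=
    fun P Q j => {g | 0 < ∑ i, u i j ^ 2 ∧
      ∑ c ∈ P ×ˢ Q, (∑ i, (u i j * y g i c.1 c.2 + u i c.1 * y g i j c.2 +
        u i c.2 * y g i j c.1)) ^ 2 ≤ (ε * ρ * m) ^ 2 * ∑ i, u i j ^ 2}
  have hB : ∀ (j : Fin n) (P Q : Finset (Fin n)), Disjoint P Q → j ∉ P → j ∉ Q → P.card = m →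
      Q.card = m → (perturbationLaw n k ρ).real (B P Q j) ≤ (2 * ε) ^ (m ^ 2) := by
    intro j P Q hPQ hjP hjQ hP hQ
    have hcard : (P ×ˢ Q).card = m ^ 2 := by rw [Finset.card_product, hP, hQ, sq]
    by_cases h0 : 0 < ∑ i, u i j ^ 2
    · have h := perturbationLaw_slice_sq_le_le hρ hε hPQ hjP hjQ x (w := fun i => u i j) u u
        (Real.sqrt_pos.mpr h0) (Real.sq_sqrt h0.le)
      rw [hcard] at h
      refine (measureReal_mono fun g hg => ?_).trans h
      refine hg.2.trans (le_of_eq ?_)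
      rw [mul_pow ρ, Real.sq_sqrt h0.le]
      push_cast
      ring
    · have : B P Q j = ∅ := Set.eq_empty_of_forall_notMem fun g hg => h0 hg.1
      rw [this, measureReal_empty]
      positivity
  have hsub : {g | ‖tensorMap (x + perturbation g) H H₁ H₂ H₃ v‖ ≤ ε * ρ * m / 2 * ‖v‖} ⊆
      ((⋃ j ∈ H₁, B H₂ H₃ j) ∪ ⋃ j ∈ H₂, B H₁ H₃ j) ∪ ⋃ j ∈ H₃, B H₁ H₂ j := by
    intro g hg
    have hle : 3 * ‖tensorMap (y g) H H₁ H₂ H₃ v‖ ^ 2 ≤ (ε * ρ * m) ^ 2 * ‖v‖ ^ 2 := by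
      have h := pow_le_pow_left₀ (norm_nonneg _) hg 2
      have h0 : 0 ≤ (ε * ρ * m) ^ 2 * ‖v‖ ^ 2 := by positivity
      have e : (ε * ρ * m / 2 * ‖v‖) ^ 2 = (ε * ρ * m) ^ 2 * ‖v‖ ^ 2 / 4 := by ring
      rw [e] at h
      linarith
    obtain ⟨j, hj0, ⟨hj, hs⟩ | ⟨hj, hs⟩ | ⟨hj, hs⟩⟩ := exists_slice_le hH hv hle
    · refine Or.inl (Or.inl (Set.mem_biUnion hj ⟨hj0, ?_⟩))
      rw [Finset.sum_product]
      exact hs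
    · refine Or.inl (Or.inr (Set.mem_biUnion hj ⟨hj0, ?_⟩))
      rw [Finset.sum_product]
      refine le_trans (le_of_eq ?_) hs
      refine Finset.sum_congr rfl fun p _ => Finset.sum_congr rfl fun r _ => ?_
      simp only [tensorEntry]
      congr 1
      refine Finset.sum_congr rfl fun i _ => ?_
      rw [hy g i j p]
      ring
    · refine Or.inr (Set.mem_biUnion hj ⟨hj0, ?_⟩)
      rw [Finset.sum_product]
      refine le_trans (le_of_eq ?_) hs
      refine Finset.sum_congr rfl fun p _ => Finset.sum_congr rfl fun q _ => ?_
      simp only [tensorEntry]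
      congr 1
      refine Finset.sum_congr rfl fun i _ => ?_
      rw [hy g i j p, hy g i j q]
      ring
  have hunion : ∀ P Q R : Finset (Fin n), Disjoint P Q → Disjoint R P → Disjoint R Q →
      P.card = m → Q.card = m → R.card = m →
      (perturbationLaw n k ρ).real (⋃ j ∈ R, B P Q j) ≤ m * (2 * ε) ^ (m ^ 2) := by
    intro P Q R hPQ hRP hRQ hP hQ hR
    refine (measureReal_biUnion_finset_le R _).trans ?_
    refine (Finset.sum_le_card_nsmul R _ _ fun j hj => hB j P Q hPQ
      (Finset.disjoint_left.mp hRP hj) (Finset.disjoint_left.mp hRQ hj) hP hQ).trans (le_of_eq ?_)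
    rw [hR, nsmul_eq_mul]
  refine (measureReal_mono hsub).trans ?_
  refine (measureReal_union_le _ _).trans ?_
  have e1 := (measureReal_union_le (μ := perturbationLaw n k ρ) (⋃ j ∈ H₁, B H₂ H₃ j)
    (⋃ j ∈ H₂, B H₁ H₃ j))
  have e2 := hunion H₂ H₃ H₁ h₂₃ h₁₂ h₁₃ hm₂ hm₃ hm₁
  have e3 := hunion H₁ H₃ H₂ h₁₃ h₁₂.symm h₂₃ hm₁ hm₃ hm₂
  have e4 := hunion H₁ H₂ H₃ h₁₂ h₁₃.symm h₂₃.symm hm₁ hm₂ hm₃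
  linarith

/-- The coefficient tensor map of a smoothed mixture is well conditioned. -/
lemma exists_event_le_norm_tensorMap (hρ : 0 < ρ) (hε : 0 < ε) (hε1 : ε ≤ 1)
    {H H₁ H₂ H₃ : Finset (Fin n)}
    (hH : ∀ φ : Fin n → ℝ, ∑ j ∈ H, φ j = ∑ j ∈ H₁, φ j + ∑ j ∈ H₂, φ j + ∑ j ∈ H₃, φ j)
    (h₁₂ : Disjoint H₁ H₂) (h₁₃ : Disjoint H₁ H₃) (h₂₃ : Disjoint H₂ H₃) {m : ℕ} (hm : 0 < m)
    (hm₁ : H₁.card = m) (hm₂ : H₂.card = m) (hm₃ : H₃.card = m)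
    (x : Fin k → Matrix (Fin n) (Fin n) ℝ) (hx : ∀ i a b, x i a b = x i b a) :
    ∃ E : Set (UpperEntries n k), MeasurableSet E ∧
      (perturbationLaw n k ρ).real Eᶜ ≤
        (3 * 6 ^ k + (864 / ε ^ 2) ^ (k * H.card) * (3 * m)) * (2 * ε) ^ (m ^ 2) ∧
      ∀ g ∈ E, ∀ v, ε * ρ * m / 8 * ‖v‖ ≤ ‖tensorMap (x + perturbation g) H H₁ H₂ H₃ v‖ := by
  have hcard : ∀ P Q : Finset (Fin n), P.card = m → Q.card = m → (P ×ˢ Q).card = m ^ 2 :=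
    fun P Q hP hQ => by rw [Finset.card_product, hP, hQ, sq]
  obtain ⟨E₁, hE₁, hE₁p, hE₁v⟩ := exists_event_block_le (k := k) hρ hε H₂ H₃
  obtain ⟨E₂, hE₂, hE₂p, hE₂v⟩ := exists_event_block_le (k := k) hρ hε H₁ H₃
  obtain ⟨E₃, hE₃, hE₃p, hE₃v⟩ := exists_event_block_le (k := k) hρ hε H₁ H₂
  rw [hcard _ _ hm₂ hm₃] at hE₁p hE₁v
  rw [hcard _ _ hm₁ hm₃] at hE₂p hE₂v
  rw [hcard _ _ hm₁ hm₂] at hE₃p hE₃v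
  have hm' : (0 : ℝ) < m := by exact_mod_cast hm
  have hε2 : ε ^ 2 ≤ 1 := pow_le_one₀ hε.le hε1
  have hβκ : ε * ρ * m / 2 ≤ 4 * (12 * ρ * m / ε) := by
    rw [← mul_div_assoc, le_div_iff₀ hε]
    nlinarith [mul_pos hρ hm']
  have hδκ : 12 * (12 * ρ * m / ε) * (ε ^ 2 / 288) ≤ ε * ρ * m / 2 := by
    refine le_of_eq ?_
    field_simp
    norm_num
  obtain ⟨E₄, hE₄, hE₄p, hE₄v⟩ := exists_event_le_norm_add_apply (μ := perturbationLaw n k ρ)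
    (tensorMap x H H₁ H₂ H₃) (fun g => tensorMap (perturbation g) H H₁ H₂ H₃)
    (κ := 12 * ρ * m / ε) (β := ε * ρ * m / 2) (δ := ε ^ 2 / 288)
    (p := 3 * m * (2 * ε) ^ (m ^ 2))
    (fun v => by simpa only [← tensorMap_add] using measurable_norm_tensorMap x H H₁ H₂ H₃ v)
    (by positivity) (by positivity) (by positivity) (by linarith) hβκ hδκ (by positivity)
    (fun v hv => by
      simpa only [← tensorMap_add] using
        perturbationLaw_norm_tensorMap_le_le hρ hε hH h₁₂ h₁₃ h₂₃ hm₁ hm₂ hm₃ x hx hv)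
  refine ⟨((E₁ ∩ E₂) ∩ E₃) ∩ E₄, ((hE₁.inter hE₂).inter hE₃).inter hE₄, ?_, fun g hg v => ?_⟩
  · simp only [Set.compl_inter]
    have e1 := measureReal_union_le (μ := perturbationLaw n k ρ) ((E₁ᶜ ∪ E₂ᶜ) ∪ E₃ᶜ) E₄ᶜ
    have e2 := measureReal_union_le (μ := perturbationLaw n k ρ) (E₁ᶜ ∪ E₂ᶜ) E₃ᶜ
    have e3 := measureReal_union_le (μ := perturbationLaw n k ρ) E₁ᶜ E₂ᶜ
    rw [finrank_euclideanSpace, Fintype.card_prod, Fintype.card_fin, Fintype.card_coe] at hE₄p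
    have e4 : (3 : ℝ) / (ε ^ 2 / 288) = 864 / ε ^ 2 := by
      field_simp
      norm_num
    rw [e4] at hE₄p
    linarith
  · rw [tensorMap_add]
    have hop : ∀ v, ‖tensorMap (perturbation g) H H₁ H₂ H₃ v‖ ≤ 12 * ρ * m / ε * ‖v‖ := by
      intro v
      refine le_of_sq_le_sq ?_ (by positivity)
      refine (norm_sq_tensorMap_le hH (hE₁v g hg.1.1.1) (hE₂v g hg.1.1.2) (hE₃v g hg.1.2) v).trans ?_
      have h0 : 0 ≤ (4 * ρ / ε) ^ 2 * (m : ℝ) ^ 2 * ‖v‖ ^ 2 := by positivity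
      have e : (12 * ρ * m / ε * ‖v‖) ^ 2 = 9 * ((4 * ρ / ε) ^ 2 * (m : ℝ) ^ 2 * ‖v‖ ^ 2) := by ring
      rw [e]
      push_cast
      linarith
    have h := hE₄v g hg.2 hop v
    refine le_trans (le_of_eq ?_) h
    ring

end BlockEvents

/-! ### The smoothing procedure succeeds with probability at least one half -/

section Success

variable {n k : ℕ} {ρ : ℝ}

/-- Tail bound for the operator norm of `Δ_i`, from a net of the unit ball of `ℝⁿ`. -/
lemma exists_event_norm_sq_perturbation_le (hρ : 0 < ρ) (i : Fin k) :
    ∃ E : Set (UpperEntries n k), MeasurableSet E ∧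
      (perturbationLaw n k ρ).real Eᶜ ≤ 6 ^ n * (Real.exp (-(1 / (256 * ρ ^ 2))) * √2 ^ n) ∧
      ∀ g ∈ E, ∀ z : EuclideanSpace ℝ (Fin n),
        ‖Matrix.toEuclideanLin (perturbation g i) z‖ ≤ 1 / 2 * ‖z‖ := by
  have hnorm : ∀ (g : UpperEntries n k) (z : EuclideanSpace ℝ (Fin n)),
      ‖Matrix.toEuclideanLin (perturbation g i) z‖ ^ 2 =
        ∑ r, (∑ i', ∑ a, (if i' = i then z a else 0) * perturbation g i' r a) ^ 2 := by
    intro g z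
    rw [EuclideanSpace.real_norm_sq_eq]
    refine Finset.sum_congr rfl fun r _ => ?_
    congr 1
    rw [Finset.sum_eq_single i (fun j _ hj => by simp [hj]) (by simp)]
    simp [Matrix.toLpLin_apply, Matrix.mulVec, dotProduct, mul_comm]
  obtain ⟨E, hE, hEp, hEv⟩ := exists_event_norm_apply_le (μ := perturbationLaw n k ρ)
    (fun g => Matrix.toEuclideanLin (perturbation g i)) (τ := 1 / 4)
    (p := Real.exp (-(1 / (256 * ρ ^ 2))) * √2 ^ n)
    (fun z => by
      have h : ∀ g : UpperEntries n k, ‖Matrix.toEuclideanLin (perturbation g i) z‖ =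
          √(∑ r, (∑ i', ∑ a, (if i' = i then z a else 0) * perturbation g i' r a) ^ 2) := by
        intro g
        rw [← hnorm, Real.sqrt_sq (norm_nonneg _)]
      simp_rw [h]
      fun_prop) (fun z hz => by
      have h1 : ∑ i', ∑ a, (if i' = i then z a else 0) ^ 2 ≤ 1 := by
        rw [Finset.sum_eq_single i (fun j _ hj => by simp [hj]) (by simp)]
        simp only [if_true]
        rw [← EuclideanSpace.real_norm_sq_eq]
        exact pow_le_one₀ (norm_nonneg _) hz
      have h := perturbationLaw_row_ge_le (k := k) hρ (1 / 16) Finset.univ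
        (v := fun i' a => if i' = i then z a else 0) h1
      rw [Finset.card_univ, Fintype.card_fin] at h
      have e : (1 : ℝ) / 16 / (4 * (ρ * 2) ^ 2) = 1 / (256 * ρ ^ 2) := by
        field_simp
        norm_num
      rw [e] at h
      refine (measureReal_mono fun g hg => ?_).trans h
      have hg' : 1 / 4 ≤ ‖Matrix.toEuclideanLin (perturbation g i) z‖ := hg
      have h2 := pow_le_pow_left₀ (by norm_num) hg' 2
      rw [hnorm] at h2
      exact le_trans (by norm_num) h2)
  refine ⟨E, hE, ?_, fun g hg z => ?_⟩
  · rwa [finrank_euclideanSpace, Fintype.card_fin] at hEp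
  · refine (hEv g hg z).trans (le_of_eq ?_)
    ring

lemma posSemidef_half_add_of_norm_le {A : Matrix (Fin n) (Fin n) ℝ} (hA : A.IsSymm)
    (h : ∀ z : EuclideanSpace ℝ (Fin n), ‖Matrix.toEuclideanLin A z‖ ≤ 1 / 2 * ‖z‖) :
    ((1 / 2 : ℝ) • (1 : Matrix (Fin n) (Fin n) ℝ) + A).PosSemidef := by
  refine Matrix.PosSemidef.of_dotProduct_mulVec_nonneg ?_ fun z => ?_
  · refine Matrix.IsHermitian.add ?_ hA
    simp [Matrix.IsHermitian]
  · set z' : EuclideanSpace ℝ (Fin n) := WithLp.toLp 2 z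
    have h1 : star z ⬝ᵥ ((1 / 2 : ℝ) • (1 : Matrix (Fin n) (Fin n) ℝ) + A).mulVec z =
        1 / 2 * ‖z'‖ ^ 2 + inner ℝ z' (Matrix.toEuclideanLin A z') := by
      rw [Matrix.add_mulVec, Matrix.smul_mulVec, Matrix.one_mulVec, dotProduct_add,
        dotProduct_smul, EuclideanSpace.real_norm_sq_eq]
      simp [z', dotProduct, PiLp.inner_apply, Matrix.toLpLin_apply, pow_two, mul_comm]
    rw [h1]
    have h2 := (abs_le.mp (abs_real_inner_le_norm z' (Matrix.toEuclideanLin A z'))).1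
    have h3 := mul_le_mul_of_nonneg_left (h z') (norm_nonneg z')
    nlinarith

/-- When every `Δ_i` has operator norm at most `1 / 2`, adding `1 / 2` to the diagonals gives an
admissible outcome. -/
lemma mem_smoothingSucceeds_of_norm_le (G : ZeroMeanMixture n k)
    (hG : ∀ i, ((1 / 2 : ℝ) • (1 : Matrix (Fin n) (Fin n) ℝ) - G.cov i).PosSemidef)
    {g : UpperEntries n k} (hg : ∀ i, ∀ z : EuclideanSpace ℝ (Fin n),
      ‖Matrix.toEuclideanLin (perturbation g i) z‖ ≤ 1 / 2 * ‖z‖) :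
    g ∈ smoothingSucceeds G := by
  refine ⟨⟨G.weight, fun i => G.cov i + ((1 / 2 : ℝ) • 1 + perturbation g i), G.weight_nonneg,
    G.weight_sum, fun i => (G.cov_posSemidef i).add (posSemidef_half_add_of_norm_le ?_ (hg i))⟩,
    rfl, fun i a b hab => ?_, fun i a => ?_⟩
  · exact Matrix.IsSymm.ext fun a b => perturbation_comm g i b a
  · simp [Matrix.one_apply_ne hab]
  · have h := (hG i).diag_nonneg (i := a)
    simp only [Matrix.sub_apply, Matrix.smul_apply, Matrix.one_apply_eq, smul_eq_mul, mul_one] at h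
    simp only [Matrix.add_apply, Matrix.smul_apply, Matrix.one_apply_eq, smul_eq_mul, mul_one,
      perturbation_self]
    linarith

/-- The threshold on `n` makes a union bound over the components and a net of the unit ball
affordable, since `ρ < 1 / n`. -/
lemma half_le_perturbationLaw_smoothingSucceeds (G : ZeroMeanMixture n k) (hρ : 0 < ρ)
    (hρn : ρ < 1 / n) (hn : 1296 ≤ n) (hk : k ≤ n)
    (hG : ∀ i, ((1 / 2 : ℝ) • (1 : Matrix (Fin n) (Fin n) ℝ) - G.cov i).PosSemidef) :
    1 / 2 ≤ (perturbationLaw n k ρ).real (smoothingSucceeds G) := by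
  choose E hE hEp hEv using fun i : Fin k => exists_event_norm_sq_perturbation_le (n := n) hρ i
  have hsub : (⋃ i, (E i)ᶜ)ᶜ ⊆ smoothingSucceeds G := by
    intro g hg
    simp only [Set.compl_iUnion, compl_compl, Set.mem_iInter] at hg
    exact mem_smoothingSucceeds_of_norm_le G hG fun i z => hEv i g (hg i) z
  refine le_trans ?_ (measureReal_mono hsub)
  rw [probReal_compl_eq_one_sub (MeasurableSet.iUnion fun i => (hE i).compl)]
  have hn' : (1296 : ℝ) ≤ n := by exact_mod_cast hn
  have hk' : (k : ℝ) ≤ n := by exact_mod_cast hk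
  have hexp : Real.exp (-(1 / (256 * ρ ^ 2))) ≤ Real.exp (-5) ^ n := by
    rw [← Real.exp_nat_mul, Real.exp_le_exp]
    have h1 : ρ * n < 1 := by rwa [lt_div_iff₀ (by linarith)] at hρn
    have h2 : (ρ * n) ^ 2 ≤ 1 := pow_le_one₀ (by positivity) h1.le
    have h3 : 5 * (n : ℝ) ≤ 1 / (256 * ρ ^ 2) := by
      rw [le_div_iff₀ (by positivity)]
      nlinarith [sq_nonneg ρ, mul_nonneg (sq_nonneg ρ) (by linarith : (0 : ℝ) ≤ n)]
    linarith
  have hbase : (6 : ℝ) * (Real.exp (-5) * √2) ≤ 1 / 2 := by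
    have h1 : √2 ≤ 3 / 2 := by
      rw [Real.sqrt_le_left (by norm_num)]; norm_num
    have h2 : Real.exp (-5) ≤ 1 / 32 := by
      rw [Real.exp_neg, one_div]
      refine inv_anti₀ (by norm_num) ?_
      have h := Real.add_one_le_exp (1 : ℝ)
      have h' : Real.exp 5 = Real.exp 1 ^ 5 := by rw [← Real.exp_nat_mul]; norm_num
      rw [h']
      calc (32 : ℝ) = (1 + 1) ^ 5 := by norm_num
        _ ≤ _ := pow_le_pow_left₀ (by norm_num) h 5
    have h3 := mul_le_mul h2 h1 (Real.sqrt_nonneg _) (by norm_num)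
    linarith
  have hterm : ∀ i, (perturbationLaw n k ρ).real (E i)ᶜ ≤ (1 / 2) ^ n := by
    intro i
    refine (hEp i).trans ?_
    calc 6 ^ n * (Real.exp (-(1 / (256 * ρ ^ 2))) * √2 ^ n)
        ≤ 6 ^ n * (Real.exp (-5) ^ n * √2 ^ n) := by gcongr
      _ = (6 * (Real.exp (-5) * √2)) ^ n := by rw [← mul_pow, ← mul_pow]
      _ ≤ (1 / 2) ^ n := pow_le_pow_left₀ (by positivity) hbase n
  have hsum : (perturbationLaw n k ρ).real (⋃ i, (E i)ᶜ) ≤ k * (1 / 2) ^ n := by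
    refine (measureReal_iUnion_fintype_le _).trans ?_
    refine (Finset.sum_le_sum fun i _ => hterm i).trans (le_of_eq ?_)
    simp
  have hfin : (k : ℝ) * (1 / 2) ^ n ≤ 1 / 2 := by
    have h1 : 2 * n ≤ 2 ^ n := by
      have h0 : n - 1 + 1 ≤ 2 ^ (n - 1) := Nat.lt_two_pow_self
      have h2 : 2 ^ n = 2 * 2 ^ (n - 1) := by
        rw [← pow_succ']; congr 1; omega
      omega
    have h2 : 2 * (n : ℝ) ≤ 2 ^ n := by exact_mod_cast h1
    rw [one_div, inv_pow, ← div_eq_mul_inv, div_le_iff₀ (by positivity)]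
    linarith
  linarith

end Success

/-! ### Fourth moments of Gaussian vectors -/

section FourthMoment

lemma integral_pow_four_gaussianReal (v : ℝ≥0) :
    ∫ x, x ^ 4 ∂(gaussianReal 0 v) = 3 * (v : ℝ) ^ 2 := by
  have h0 : (0 : ℝ) ∈ interior (integrableExpSet id (gaussianReal 0 v)) := by
    rw [integrableExpSet_id_gaussianReal, interior_univ]; exact Set.mem_univ _
  have h1 := iteratedDeriv_mgf_zero h0 4
  have h2 : ∫ x, x ^ 4 ∂(gaussianReal 0 v) = (gaussianReal 0 v)[id ^ 4] := rfl
  rw [h2, ← h1, mgf_id_gaussianReal]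
  have he : ∀ t : ℝ, HasDerivAt (fun t : ℝ => Real.exp (0 * t + v * t ^ 2 / 2))
      (v * t * Real.exp (0 * t + v * t ^ 2 / 2)) t := by
    intro t
    have h : HasDerivAt (fun t : ℝ => 0 * t + v * t ^ 2 / 2) (v * t) t := by
      have := ((hasDerivAt_id t).const_mul 0).add
        (((hasDerivAt_pow 2 t).const_mul (v : ℝ)).div_const 2)
      convert! this using 1
      push_cast
      ring
    convert! h.exp using 1
    ring
  have hp : ∀ (p : ℝ → ℝ) (p' : ℝ → ℝ), (∀ t, HasDerivAt p (p' t) t) →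
      deriv (fun t => p t * Real.exp (0 * t + v * t ^ 2 / 2)) =
        fun t => (p' t + v * t * p t) * Real.exp (0 * t + v * t ^ 2 / 2) := by
    intro p p' h
    funext t
    refine ((h t).mul (he t)).deriv.trans ?_
    ring
  have d1 : deriv (fun t : ℝ => Real.exp (0 * t + v * t ^ 2 / 2)) =
      fun t => (v * t) * Real.exp (0 * t + v * t ^ 2 / 2) := funext fun t => (he t).deriv
  have q1 : ∀ t : ℝ, HasDerivAt (fun t : ℝ => (v : ℝ) * t) v t := fun t => by
    simpa using (hasDerivAt_id t).const_mul (v : ℝ)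
  have q2 : ∀ t : ℝ, HasDerivAt (fun t : ℝ => (v : ℝ) + v * t * (v * t)) (2 * v ^ 2 * t) t :=
    fun t => by
      convert! (((q1 t).mul (q1 t)).const_add (v : ℝ)) using 1
      ring
  have q3 : ∀ t : ℝ, HasDerivAt
      (fun t : ℝ => 2 * (v : ℝ) ^ 2 * t + v * t * (v + v * t * (v * t)))
      (2 * v ^ 2 + (v * (v + v * t * (v * t)) + v * t * (2 * v ^ 2 * t))) t := fun t => by
    convert! ((hasDerivAt_id t).const_mul (2 * (v : ℝ) ^ 2)).add ((q1 t).mul (q2 t)) using 1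
    ring
  rw [iteratedDeriv_succ, iteratedDeriv_succ, iteratedDeriv_succ, iteratedDeriv_one, d1,
    hp _ _ q1, hp _ _ q2, hp _ _ q3]
  simp
  ring

variable {E : Type*} [NormedAddCommGroup E] [InnerProductSpace ℝ E] [MeasurableSpace E]
  [BorelSpace E] (μ : Measure E) [IsGaussian μ]

lemma integrable_inner_pow_four (u : E) : Integrable (fun x => inner ℝ u x ^ 4) μ := by
  have h : MemLp (fun x => innerSL ℝ u x) 4 μ := IsGaussian.memLp_dual μ (innerSL ℝ u) 4 (by simp)
  have h2 := h.integrable_norm_pow (p := 4) (by norm_num)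
  refine h2.congr (ae_of_all _ fun x => ?_)
  simp only [innerSL_apply_apply, Real.norm_eq_abs]
  exact (show Even 4 by decide).pow_abs _

variable [CompleteSpace E] [SecondCountableTopology E]

/-- The marginal along `u` is a centred Gaussian on the line with variance `covarianceBilin μ u u`. -/
lemma integral_inner_pow_four (hμ : ∫ x, x ∂μ = 0) (u : E) :
    ∫ x, inner ℝ u x ^ 4 ∂μ = 3 * covarianceBilin μ u u ^ 2 := by
  have hmap := IsGaussian.map_eq_gaussianReal (μ := μ) (innerSL ℝ u)
  have hmean : ∫ x, innerSL ℝ u x ∂μ = 0 := by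
    rw [(innerSL ℝ u).integral_comp_id_comm IsGaussian.integrable_id, hμ, map_zero]
  have hvar : Var[fun x => innerSL ℝ u x; μ] = covarianceBilin μ u u := by
    rw [covarianceBilin_apply_eq_cov IsGaussian.memLp_two_id, covariance_self]
    · rfl
    · exact Measurable.aemeasurable (by fun_prop)
  have hnonneg : 0 ≤ covarianceBilin μ u u := hvar ▸ variance_nonneg _ _
  have h1 : ∫ x, inner ℝ u x ^ 4 ∂μ = ∫ y, y ^ 4 ∂(μ.map (innerSL ℝ u)) := by
    rw [integral_map (by fun_prop) (by fun_prop)]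
    rfl
  rw [h1, hmap, hmean, integral_pow_four_gaussianReal]
  rw [hvar, Real.coe_toNNReal _ hnonneg]

/-- The fourth mixed moments of a centred Gaussian vector, by polarization of
`E ⟨u, x⟩⁴ = 3 (Var ⟨u, x⟩)²` over the signs in `u = a ± b ± c ± d`. -/
lemma integral_inner_mul_four (hμ : ∫ x, x ∂μ = 0) (a b c d : E) :
    Integrable (fun x => inner ℝ a x * inner ℝ b x * inner ℝ c x * inner ℝ d x) μ ∧
    ∫ x, inner ℝ a x * inner ℝ b x * inner ℝ c x * inner ℝ d x ∂μ =
      covarianceBilin μ a b * covarianceBilin μ c d +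
      covarianceBilin μ a c * covarianceBilin μ b d +
      covarianceBilin μ a d * covarianceBilin μ b c := by
  have hpol : (fun x => inner ℝ a x * inner ℝ b x * inner ℝ c x * inner ℝ d x) = fun x =>
      (1 / 192 : ℝ) * (((inner ℝ (a + b + c + d) x ^ 4 - inner ℝ (a + b + c - d) x ^ 4) +
        (inner ℝ (a + b - c - d) x ^ 4 - inner ℝ (a + b - c + d) x ^ 4)) +
        ((inner ℝ (a - b + c - d) x ^ 4 - inner ℝ (a - b + c + d) x ^ 4) +
        (inner ℝ (a - b - c + d) x ^ 4 - inner ℝ (a - b - c - d) x ^ 4))) := by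
    funext x
    simp only [inner_add_left, inner_sub_left]
    ring
  have i := integrable_inner_pow_four μ
  have h1 := (i (a + b + c + d)).sub (i (a + b + c - d))
  have h2 := (i (a + b - c - d)).sub (i (a + b - c + d))
  have h3 := (i (a - b + c - d)).sub (i (a - b + c + d))
  have h4 := (i (a - b - c + d)).sub (i (a - b - c - d))
  rw [hpol]
  refine ⟨((h1.add h2).add (h3.add h4)).const_mul _, ?_⟩
  rw [integral_const_mul]
  erw [integral_add (h1.add h2) (h3.add h4), integral_add h1 h2, integral_add h3 h4,
    integral_sub (i _) (i _), integral_sub (i _) (i _), integral_sub (i _) (i _),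
    integral_sub (i _) (i _)]
  simp only [integral_inner_pow_four μ hμ, map_add, map_sub, add_apply,
    sub_apply]
  rw [covarianceBilin_comm b a, covarianceBilin_comm c a,
    covarianceBilin_comm d a, covarianceBilin_comm c b,
    covarianceBilin_comm d b, covarianceBilin_comm d c]
  ring

variable {n k : ℕ}

lemma integral_mul_four_multivariateGaussian {S : Matrix (Fin n) (Fin n) ℝ} (hS : S.PosSemidef)
    (a b c d : Fin n) :
    Integrable (fun x : EuclideanSpace ℝ (Fin n) => x a * x b * x c * x d)
      (multivariateGaussian 0 S) ∧
    ∫ x : EuclideanSpace ℝ (Fin n), x a * x b * x c * x d ∂(multivariateGaussian 0 S) =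
      S a b * S c d + S a c * S b d + S a d * S b c := by
  have h := integral_inner_mul_four (multivariateGaussian 0 S) integral_id_multivariateGaussian
    (EuclideanSpace.basisFun (Fin n) ℝ a) (EuclideanSpace.basisFun (Fin n) ℝ b)
    (EuclideanSpace.basisFun (Fin n) ℝ c) (EuclideanSpace.basisFun (Fin n) ℝ d)
  simp only [covarianceBilin_multivariateGaussian hS] at h
  simpa [EuclideanSpace.inner_single_left] using h

lemma ZeroMeanMixture.fourthMoment_eq (G : ZeroMeanMixture n k) (a b c d : Fin n) :
    G.fourthMoment a b c d = ∑ i, G.weight i *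
      (G.cov i a b * G.cov i c d + G.cov i a c * G.cov i b d + G.cov i a d * G.cov i b c) := by
  rw [fourthMoment, law, integral_finsetSum_measure]
  · refine Finset.sum_congr rfl fun i _ => ?_
    rw [integral_smul_measure,
      (integral_mul_four_multivariateGaussian (G.cov_posSemidef i) a b c d).2,
      ENNReal.toReal_ofReal (G.weight_nonneg i), smul_eq_mul]
  · intro i _
    exact (integral_mul_four_multivariateGaussian (G.cov_posSemidef i) a b c d).1.smul_measure
      ENNReal.ofReal_ne_top

end FourthMoment

/-! ### The slice matrix as a product -/

section Factorization

variable {n k : ℕ}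

/-- Weighted linear combinations of the covariance columns `Σ_i[:, j]`, `j ∈ H`. -/
noncomputable def ZeroMeanMixture.weightedColumnMap (G : ZeroMeanMixture n k) (H : Finset (Fin n)) :
    EuclideanSpace ℝ (Fin k × H) →ₗ[ℝ] EuclideanSpace ℝ (Fin n) where
  toFun v := WithLp.toLp 2 fun r => ∑ i, ∑ a, extendZero H v i a * (G.weight i * G.cov i r a)
  map_add' v w := by
    ext r
    simp [add_mul, Finset.sum_add_distrib]
  map_smul' c v := by
    ext r
    simp [mul_assoc, Finset.mul_sum]

namespace ZeroMeanMixture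

lemma weightedColumnMap_apply (G : ZeroMeanMixture n k) (H : Finset (Fin n))
    (v : EuclideanSpace ℝ (Fin k × H)) (r : Fin n) :
    G.weightedColumnMap H v r = ∑ i, ∑ a, extendZero H v i a * (G.weight i * G.cov i r a) := rfl

lemma cov_comm (G : ZeroMeanMixture n k) (i : Fin k) (a b : Fin n) :
    G.cov i a b = G.cov i b a := by
  simpa using (G.cov_posSemidef i).isHermitian.apply b a

/-- The slice matrix is the matrix of weighted covariance columns times the transpose of the
coefficient tensor map: this is the formula for the fourth moments of a Gaussian. -/
lemma toEuclideanLin_sliceMatrix (G : ZeroMeanMixture n k) {H H₁ H₂ H₃ : Finset (Fin n)}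
    (h₁ : H₁ ⊆ H) (h₂ : H₂ ⊆ H) (h₃ : H₃ ⊆ H) :
    Matrix.toEuclideanLin (G.sliceMatrix H₁ H₂ H₃) =
      G.weightedColumnMap H ∘ₗ (tensorMap G.cov H H₁ H₂ H₃).adjoint := by
  ext1 u
  ext r
  let z : EuclideanSpace ℝ (Fin k × H) := WithLp.toLp 2 fun c => G.weight c.1 * G.cov c.1 r c.2
  have hz : ∀ i, ∀ a ∈ H, extendZero H z i a = G.weight i * G.cov i r a := fun i a ha =>
    extendZero_apply_coe z i ⟨a, ha⟩
  have hentry : ∀ c, G.sliceMatrix H₁ H₂ H₃ r c = tensorMap G.cov H H₁ H₂ H₃ z c := by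
    intro c
    rw [tensorMap_apply, sliceMatrix, Matrix.of_apply, fourthMoment_eq, tensorEntry]
    refine Finset.sum_congr rfl fun i _ => ?_
    rw [hz i _ (h₁ c.1.2), hz i _ (h₂ c.2.1.2), hz i _ (h₃ c.2.2.2), G.cov_comm i r c.1,
      G.cov_comm i r c.2.1, G.cov_comm i r c.2.2]
    ring
  have hleft : Matrix.toEuclideanLin (G.sliceMatrix H₁ H₂ H₃) u r =
      inner ℝ (tensorMap G.cov H H₁ H₂ H₃ z) u := by
    rw [PiLp.inner_apply, Matrix.toLpLin_apply]
    simp only [Matrix.mulVec, dotProduct]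
    refine Finset.sum_congr rfl fun c _ => ?_
    rw [hentry]
    simp [mul_comm]
  rw [hleft, ← LinearMap.adjoint_inner_right, LinearMap.comp_apply, weightedColumnMap_apply,
    sum_mul_extendZero _ fun i a => G.weight i * G.cov i r a, PiLp.inner_apply]
  rfl

/-- The rows outside `R` only add to the norm, and every coefficient is scaled by a weight of at
least `ω₀`. -/
lemma le_norm_weightedColumnMap (G : ZeroMeanMixture n k) {R H : Finset (Fin n)} {ω₀ α : ℝ}
    (hω₀ : 0 ≤ ω₀) (hω : ∀ i, ω₀ ≤ G.weight i) (hα : 0 ≤ α)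
    (h : ∀ v, α * ‖v‖ ≤ ‖rowMap G.cov R H v‖) (v : EuclideanSpace ℝ (Fin k × H)) :
    α * ω₀ * ‖v‖ ≤ ‖G.weightedColumnMap H v‖ := by
  let z : EuclideanSpace ℝ (Fin k × H) := WithLp.toLp 2 fun c => G.weight c.1 * v c
  have hz : ∀ i a, extendZero H z i a = G.weight i * extendZero H v i a := by
    intro i a
    by_cases ha : a ∈ H
    · rw [extendZero_apply_coe z i ⟨a, ha⟩, extendZero_apply_coe v i ⟨a, ha⟩]
    · rw [extendZero_of_notMem z i ha, extendZero_of_notMem v i ha, mul_zero]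
  have h1 : ω₀ * ‖v‖ ≤ ‖z‖ := by
    refine le_of_sq_le_sq ?_ (norm_nonneg _)
    rw [mul_pow, EuclideanSpace.real_norm_sq_eq, EuclideanSpace.real_norm_sq_eq, Finset.mul_sum]
    refine Finset.sum_le_sum fun c _ => ?_
    have : z c = G.weight c.1 * v c := rfl
    rw [this, mul_pow]
    exact mul_le_mul_of_nonneg_right (pow_le_pow_left₀ hω₀ (hω c.1) 2) (sq_nonneg _)
  have h2 : ‖rowMap G.cov R H z‖ ≤ ‖G.weightedColumnMap H v‖ := by
    refine le_of_sq_le_sq ?_ (norm_nonneg _)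
    rw [norm_sq_rowMap, EuclideanSpace.real_norm_sq_eq]
    refine le_trans (le_of_eq ?_) (Finset.sum_le_sum_of_subset_of_nonneg (Finset.subset_univ R)
      fun r _ _ => sq_nonneg _)
    refine Finset.sum_congr rfl fun r _ => ?_
    rw [weightedColumnMap_apply]
    congr 1
    refine Finset.sum_congr rfl fun i _ => Finset.sum_congr rfl fun a _ => ?_
    rw [hz]
    ring
  calc α * ω₀ * ‖v‖ = α * (ω₀ * ‖v‖) := by ring
    _ ≤ α * ‖z‖ := mul_le_mul_of_nonneg_left h1 hα
    _ ≤ _ := (h z).trans h2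

lemma range_col_sliceMatrix_subset (G : ZeroMeanMixture n k) {H H₁ H₂ H₃ : Finset (Fin n)}
    (h₁ : H₁ ⊆ H) (h₂ : H₂ ⊆ H) (h₃ : H₃ ⊆ H) :
    Set.range (G.sliceMatrix H₁ H₂ H₃).col ⊆ G.columnSpan H := by
  rintro _ ⟨c, rfl⟩
  have hmem : ∀ i, ∀ j ∈ H, (fun r => G.cov i r j) ∈ G.columnSpan H := fun i j hj =>
    Submodule.subset_span ⟨i, j, hj, rfl⟩
  have hcol : (G.sliceMatrix H₁ H₂ H₃).col c = ∑ i, G.weight i •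
      ((G.cov i c.1 c.2.1 • fun r => G.cov i r c.2.2) +
        (G.cov i c.1 c.2.2 • fun r => G.cov i r c.2.1) +
        (G.cov i c.2.1 c.2.2 • fun r => G.cov i r c.1)) := by
    funext r
    rw [Matrix.col_apply, sliceMatrix, Matrix.of_apply, fourthMoment_eq, Finset.sum_apply]
    refine Finset.sum_congr rfl fun i _ => ?_
    simp only [Pi.smul_apply, Pi.add_apply, smul_eq_mul]
    rw [G.cov_comm i r c.1, G.cov_comm i r c.2.1, G.cov_comm i r c.2.2]
    ring
  rw [hcol]
  refine Submodule.sum_mem _ fun i _ => Submodule.smul_mem _ _ ?_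
  exact Submodule.add_mem _ (Submodule.add_mem _
    (Submodule.smul_mem _ _ (hmem i _ (h₃ c.2.2.2))) (Submodule.smul_mem _ _ (hmem i _ (h₂ c.2.1.2))))
    (Submodule.smul_mem _ _ (hmem i _ (h₁ c.1.2)))

/-- When the coefficient tensor map is injective its transpose is onto, so that every covariance
column is a combination of the moment slices. -/
lemma span_range_col_sliceMatrix (G : ZeroMeanMixture n k) {H H₁ H₂ H₃ : Finset (Fin n)}
    (h₁ : H₁ ⊆ H) (h₂ : H₂ ⊆ H) (h₃ : H₃ ⊆ H) (hω : ∀ i, 0 < G.weight i)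
    (hinj : Function.Injective (tensorMap G.cov H H₁ H₂ H₃)) :
    Submodule.span ℝ (Set.range (G.sliceMatrix H₁ H₂ H₃).col) = G.columnSpan H := by
  refine le_antisymm (Submodule.span_le.mpr (G.range_col_sliceMatrix_subset h₁ h₂ h₃)) ?_
  refine Submodule.span_le.mpr ?_
  rintro _ ⟨i, j, hj, rfl⟩
  obtain ⟨u, hu⟩ := LinearMap.adjoint_surjective_of_injective hinj
    (EuclideanSpace.single (i, ⟨j, hj⟩) (G.weight i)⁻¹)
  have hlin := LinearMap.congr_fun (G.toEuclideanLin_sliceMatrix h₁ h₂ h₃) u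
  rw [LinearMap.comp_apply, hu] at hlin
  rw [← Matrix.range_mulVecLin]
  refine ⟨WithLp.ofLp u, funext fun r => ?_⟩
  have hr := congrArg (fun z : EuclideanSpace ℝ (Fin n) => z r) hlin
  simp only [weightedColumnMap_apply] at hr
  rw [sum_mul_extendZero _ fun i a => G.weight i * G.cov i r a] at hr
  have hsum : ∑ c : Fin k × H, EuclideanSpace.single (i, (⟨j, hj⟩ : H)) (G.weight i)⁻¹ c *
      (G.weight c.1 * G.cov c.1 r c.2) = G.cov i r j := by
    rw [Finset.sum_eq_single (i, (⟨j, hj⟩ : H))]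
    · have := (hω i).ne'
      simp [this]
    · intro c _ hc
      simp [hc]
    · simp
  rw [hsum] at hr
  exact hr

end ZeroMeanMixture

section Outcome

variable {G G' : ZeroMeanMixture n k} {g : UpperEntries n k}

/-- Rows that avoid `H` meet the columns in `H` off the diagonal, where the outcome is determined. -/
lemma IsSmoothedOutcome.rowMap_eq (h : IsSmoothedOutcome G g G') {R H : Finset (Fin n)}
    (hRH : Disjoint R H) : rowMap G'.cov R H = rowMap (G.cov + perturbation g) R H := by
  ext v r
  rw [rowMap_apply, rowMap_apply]
  refine Finset.sum_congr rfl fun i _ => Finset.sum_congr rfl fun a _ => ?_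
  by_cases ha : a ∈ H
  · rw [h.offDiag i r a fun hra => Finset.disjoint_left.mp hRH r.2 (hra ▸ ha)]
    rfl
  · rw [extendZero_of_notMem v i ha, zero_mul, zero_mul]

/-- The three parts being disjoint, the coefficient tensor uses off-diagonal entries only. -/
lemma IsSmoothedOutcome.tensorMap_eq (h : IsSmoothedOutcome G g G') {H H₁ H₂ H₃ : Finset (Fin n)}
    (h₁₂ : Disjoint H₁ H₂) (h₁₃ : Disjoint H₁ H₃) (h₂₃ : Disjoint H₂ H₃) :
    tensorMap G'.cov H H₁ H₂ H₃ = tensorMap (G.cov + perturbation g) H H₁ H₂ H₃ := by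
  ext v c
  rw [tensorMap_apply, tensorMap_apply, tensorEntry, tensorEntry]
  refine Finset.sum_congr rfl fun i _ => ?_
  rw [h.offDiag i c.2.1 c.2.2 fun e => Finset.disjoint_left.mp h₂₃ c.2.1.2 (e ▸ c.2.2.2),
    h.offDiag i c.1 c.2.2 fun e => Finset.disjoint_left.mp h₁₃ c.1.2 (e ▸ c.2.2.2),
    h.offDiag i c.1 c.2.1 fun e => Finset.disjoint_left.mp h₁₂ c.1.2 (e ▸ c.2.1.2)]
  rfl

/-- The deterministic conclusion: if the coefficient tensor map and the covariance rows off `H`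
are well conditioned, then so is the slice matrix, and its columns span all covariance columns. -/
lemma IsSmoothedOutcome.singularValue_and_span (h : IsSmoothedOutcome G g G')
    {R H H₁ H₂ H₃ : Finset (Fin n)} (hRH : Disjoint R H)
    (h₁ : H₁ ⊆ H) (h₂ : H₂ ⊆ H) (h₃ : H₃ ⊆ H)
    (h₁₂ : Disjoint H₁ H₂) (h₁₃ : Disjoint H₁ H₃) (h₂₃ : Disjoint H₂ H₃) {ω₀ α β : ℝ}
    (hω₀ : 0 < ω₀) (hω : ∀ i, ω₀ ≤ G.weight i) (hα : 0 ≤ α) (hβ : 0 < β)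
    (hrow : ∀ v, α * ‖v‖ ≤ ‖rowMap (G.cov + perturbation g) R H v‖)
    (hten : ∀ v, β * ‖v‖ ≤ ‖tensorMap (G.cov + perturbation g) H H₁ H₂ H₃ v‖)
    (hk : 0 < k * H.card) :
    α * ω₀ * β ≤ matrixSingularValue (G'.sliceMatrix H₁ H₂ H₃) (k * H.card) ∧
      Submodule.span ℝ (Set.range (G'.sliceMatrix H₁ H₂ H₃).col) = G'.columnSpan H := by
  rw [← h.rowMap_eq hRH] at hrow
  rw [← h.tensorMap_eq h₁₂ h₁₃ h₂₃] at hten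
  have hω' : ∀ i, ω₀ ≤ G'.weight i := by rwa [h.weight_eq]
  refine ⟨?_, G'.span_range_col_sliceMatrix h₁ h₂ h₃ (fun i => hω₀.trans_le (hω' i)) ?_⟩
  · rw [matrixSingularValue, G'.toEuclideanLin_sliceMatrix h₁ h₂ h₃]
    refine LinearMap.le_singularValues_comp_adjoint _ _ (by positivity) hβ
      (G'.le_norm_weightedColumnMap hω₀.le hω' hα hrow) hten ?_
    rw [finrank_euclideanSpace, Fintype.card_prod, Fintype.card_fin, Fintype.card_coe]
    omega
  · rw [injective_iff_map_eq_zero]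
    intro v hv
    have := hten v
    rw [hv, norm_zero] at this
    exact norm_le_zero_iff.mp (nonpos_of_mul_nonpos_right this hβ)

end Outcome

end Factorization

/-! ### The probability estimate -/

/-- Conditioning on `S`, which need not be measurable, at most doubles the probability of `Eᶜ`. -/
lemma one_sub_le_cond_real {Ω : Type*} [MeasurableSpace Ω] {μ : Measure Ω} [IsProbabilityMeasure μ]
    {S E : Set Ω} (hE : MeasurableSet E) (hS : 1 / 2 ≤ μ.real S) :
    1 - 2 * μ.real Eᶜ ≤ (ProbabilityTheory.cond μ S).real E := by
  have hS0 : μ S ≠ 0 := fun h => by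
    rw [measureReal_def, h] at hS
    norm_num at hS
  have := cond_isProbabilityMeasure hS0
  have h1 : (ProbabilityTheory.cond μ S).real Eᶜ ≤ 2 * μ.real Eᶜ := by
    rw [measureReal_def, cond_apply' hE.compl, ENNReal.toReal_mul, ENNReal.toReal_inv]
    refine mul_le_mul ?_ (measureReal_mono Set.inter_subset_right) measureReal_nonneg zero_le_two
    rw [← measureReal_def]
    exact inv_le_of_inv_le₀ two_pos (by linarith)
  rw [probReal_compl_eq_one_sub hE] at h1
  linarith

/-- The sum of the failure probabilities: the `(1 / ε)`-powers from the nets are absorbed by the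
small ball probabilities `(2 ε) ^ m²`, because the dimension `d` is at most a quarter of `m²`. -/
lemma failure_probability_le {ε : ℝ} (hε : 0 < ε) (hε1 : 36864 * ε ≤ 1) {m k d N : ℕ} (hm : 0 < m)
    (hkd : k ≤ d) (hd : 4 * d ≤ m ^ 2) (hN : m ^ 2 ≤ N) :
    2 * ((6 ^ d + (864 / ε ^ 2) ^ d) * (2 * ε) ^ N +
      (3 * 6 ^ k + (864 / ε ^ 2) ^ d * (3 * m)) * (2 * ε) ^ (m ^ 2)) ≤
      (36864 * ε) ^ (1 / 18 * ((9 * m ^ 2 : ℕ) : ℝ)) := by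
  set X : ℝ := 864 / ε ^ 2 with hX
  have hεs : ε ≤ 1 := by linarith
  have hε2 : ε ^ 2 ≤ 1 := pow_le_one₀ hε.le hεs
  have hX6 : 6 ≤ X := by
    rw [hX, le_div_iff₀ (by positivity)]
    linarith
  have h1 : (6 : ℝ) ^ d ≤ X ^ d := pow_le_pow_left₀ (by norm_num) hX6 d
  have h2 : (6 : ℝ) ^ k ≤ X ^ d := (pow_le_pow_right₀ (by norm_num) hkd).trans h1
  have h3 : (2 * ε) ^ N ≤ (2 * ε) ^ (m ^ 2) := pow_le_pow_of_le_one (by positivity) (by linarith) hN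
  have hm1 : (1 : ℝ) ≤ m := by exact_mod_cast hm
  have h16 : 16 * (m : ℝ) ≤ 16 ^ (m ^ 2) := by
    have e1 : m ≤ 16 ^ (m - 1) := by
      have : m - 1 + 1 ≤ 16 ^ (m - 1) := Nat.lt_pow_self (by norm_num)
      omega
    have e2 : 16 * m ≤ 16 ^ m := by
      calc 16 * m ≤ 16 * 16 ^ (m - 1) := by omega
        _ = 16 ^ m := by rw [← pow_succ']; congr 1; omega
    have e3 : (16 : ℕ) ^ m ≤ 16 ^ (m ^ 2) :=
      Nat.pow_le_pow_right (by norm_num) (Nat.le_self_pow two_ne_zero m)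
    exact_mod_cast e2.trans e3
  have hY : 0 < √ε := Real.sqrt_pos.mpr hε
  have hYs : √ε ^ 2 = ε := Real.sq_sqrt hε.le
  -- `6 / √ε` is an upper bound for the fourth root of `864 / ε²`
  have hXd : X ^ d ≤ (6 / √ε) ^ (m ^ 2) := by
    have e1 : X ≤ (6 / √ε) ^ 4 := by
      rw [div_pow, show √ε ^ 4 = (√ε ^ 2) ^ 2 by ring, hYs, hX]
      exact div_le_div_of_nonneg_right (by norm_num) (by positivity)
    have e2 : 1 ≤ 6 / √ε := by
      rw [le_div_iff₀ hY, one_mul]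
      exact (Real.sqrt_le_one.mpr hεs).trans (by norm_num)
    calc X ^ d ≤ ((6 / √ε) ^ 4) ^ d := pow_le_pow_left₀ (by linarith) e1 d
      _ = (6 / √ε) ^ (4 * d) := by rw [pow_mul]
      _ ≤ _ := pow_le_pow_right₀ e2 hd
  have hXd0 : 0 < X ^ d := by positivity
  have hp0 : 0 < (2 * ε) ^ (m ^ 2) := by positivity
  calc 2 * ((6 ^ d + X ^ d) * (2 * ε) ^ N + (3 * 6 ^ k + X ^ d * (3 * m)) * (2 * ε) ^ (m ^ 2))
      ≤ 2 * ((X ^ d + X ^ d) * (2 * ε) ^ (m ^ 2) +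
          (3 * X ^ d + X ^ d * (3 * m)) * (2 * ε) ^ (m ^ 2)) := by gcongr
    _ = (6 * m + 10) * (X ^ d * (2 * ε) ^ (m ^ 2)) := by ring
    _ ≤ 16 ^ (m ^ 2) * (X ^ d * (2 * ε) ^ (m ^ 2)) :=
        mul_le_mul_of_nonneg_right (by linarith) (by positivity)
    _ ≤ 16 ^ (m ^ 2) * ((6 / √ε) ^ (m ^ 2) * (2 * ε) ^ (m ^ 2)) := by gcongr
    _ = √(36864 * ε) ^ (m ^ 2) := by
        rw [← mul_pow, ← mul_pow]
        congr 1
        rw [show (36864 : ℝ) = 192 ^ 2 by norm_num, Real.sqrt_mul (by norm_num),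
          Real.sqrt_sq (by norm_num), div_mul_eq_mul_div, mul_div_assoc', div_eq_iff hY.ne']
        rw [mul_assoc 192, ← sq, hYs]
        ring
    _ = _ := by
        rw [Real.sqrt_eq_rpow, ← Real.rpow_natCast, ← Real.rpow_mul (by positivity)]
        congr 1
        push_cast
        ring

theorem mainTheorem7 :
    ∃ C₀ C₁ C₂ C₃ : ℝ, 0 < C₀ ∧ 0 < C₁ ∧ 0 < C₂ ∧ 0 < C₃ ∧
      ∀ (n k : ℕ) (ρ ω₀ : ℝ) (G : ZeroMeanMixture n k) (H H₁ H₂ H₃ : Finset (Fin n)) (ε : ℝ),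
        C₀ * (k : ℝ) ^ 2 ≤ n →
        0 < ρ → ρ < 1 / n →
        0 < ω₀ → (∀ i, ω₀ ≤ G.weight i) →
        (∀ i, ((1 / 2 : ℝ) • (1 : Matrix (Fin n) (Fin n) ℝ) - G.cov i).PosSemidef) →
        H.card ^ 2 = n →
        H₁ ∪ H₂ ∪ H₃ = H → Disjoint H₁ H₂ → Disjoint H₁ H₃ → Disjoint H₂ H₃ →
        H₁.card = H₂.card → H₂.card = H₃.card →
        0 < ε →
        ∃ E : Set (UpperEntries n k), MeasurableSet E ∧
          1 - (C₁ * ε) ^ (C₂ * (n : ℝ)) ≤ (perturbationLaw n k ρ).real E ∧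
          1 - (C₁ * ε) ^ (C₂ * (n : ℝ)) ≤
            (ProbabilityTheory.cond (perturbationLaw n k ρ) (smoothingSucceeds G)).real E ∧
          ∀ g ∈ E, ∀ G' : ZeroMeanMixture n k, IsSmoothedOutcome G g G' →
            C₃ * ω₀ * ε ^ 2 * ρ ^ 2 * n ≤
                matrixSingularValue (G'.sliceMatrix H₁ H₂ H₃) (k * H.card) ∧
              Submodule.span ℝ (Set.range (G'.sliceMatrix H₁ H₂ H₃).col) =
                G'.columnSpan H := by
  -- `n = 9 m²` and `1296 k² ≤ n` give `12 k ≤ m`, that is, `4 k |H| ≤ m²`; the failure probability is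
  -- `√(36864 ε) ^ (m²)`, with `m² = n / 9`; and `9 / 192 = (3 / 8) * (1 / 8)`
  refine ⟨1296, 36864, 1 / 18, 1 / 192, by norm_num, by norm_num, by norm_num, by norm_num, ?_⟩
  intro n k ρ ω₀ G H H₁ H₂ H₃ ε hnk hρ hρn hω₀ hω hG hHn hHu h₁₂ h₁₃ h₂₃ hc₁₂ hc₂₃ hε
  -- for large `ε` the probability bounds are void
  rcases le_or_gt 1 (36864 * ε) with hε1 | hε1
  · have h1 : 1 ≤ (36864 * ε) ^ (1 / 18 * (n : ℝ)) := Real.one_le_rpow hε1 (by positivity)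
    refine ⟨∅, MeasurableSet.empty, ?_, ?_, fun g hg => absurd hg (Set.notMem_empty g)⟩ <;>
      rw [measureReal_empty] <;> linarith
  have hεs : ε ≤ 1 := by linarith
  have hk : 0 < k := by
    rcases Nat.eq_zero_or_pos k with rfl | hk
    · have := G.weight_sum
      simp at this
    · exact hk
  set m := H₁.card with hm
  have hm₂ : H₂.card = m := hc₁₂.symm
  have hm₃ : H₃.card = m := hc₂₃ ▸ hm₂
  have hd₁₂₃ : Disjoint (H₁ ∪ H₂) H₃ := Finset.disjoint_union_left.mpr ⟨h₁₃, h₂₃⟩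
  have hHcard : H.card = 3 * m := by
    rw [← hHu, Finset.card_union_of_disjoint hd₁₂₃, Finset.card_union_of_disjoint h₁₂, hm₂, hm₃,
      ← hm]
    ring
  have hn : n = 9 * m ^ 2 := by rw [← hHn, hHcard]; ring
  have hkm : 12 * k ≤ m := by
    have h1 : 1296 * k ^ 2 ≤ n := by exact_mod_cast hnk
    rw [hn] at h1
    by_contra! hlt
    nlinarith
  have hm0 : 0 < m := by omega
  have hsum : ∀ φ : Fin n → ℝ,
      ∑ j ∈ H, φ j = ∑ j ∈ H₁, φ j + ∑ j ∈ H₂, φ j + ∑ j ∈ H₃, φ j := fun φ => by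
    rw [← hHu, Finset.sum_union hd₁₂₃, Finset.sum_union h₁₂]
  have hRH : Disjoint Hᶜ H := disjoint_compl_left
  have hRcard : Hᶜ.card = 9 * m ^ 2 - 3 * m := by
    rw [Finset.card_compl, Fintype.card_fin, hHcard, hn]
  have hmm : m ≤ m ^ 2 := Nat.le_self_pow two_ne_zero m
  have hRm : m ^ 2 ≤ Hᶜ.card := by omega
  have hR : (Hᶜ : Finset (Fin n)).Nonempty :=
    Finset.card_pos.mp ((pow_pos hm0 2).trans_le hRm)
  have hcovsymm : ∀ i a b, G.cov i a b = G.cov i b a := G.cov_comm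
  obtain ⟨E₁, hE₁, hE₁p, hE₁v⟩ := exists_event_le_norm_rowMap hρ hε hεs hRH hR G.cov
  obtain ⟨E₂, hE₂, hE₂p, hE₂v⟩ := exists_event_le_norm_tensorMap hρ hε hεs hsum h₁₂ h₁₃ h₂₃ hm0 rfl
    hm₂ hm₃ G.cov hcovsymm
  have hE : MeasurableSet (E₁ ∩ E₂) := hE₁.inter hE₂
  have hbad : 2 * (perturbationLaw n k ρ).real (E₁ ∩ E₂)ᶜ ≤
      (36864 * ε) ^ (1 / 18 * (n : ℝ)) := by
    have h1 := measureReal_union_le (μ := perturbationLaw n k ρ) E₁ᶜ E₂ᶜ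
    rw [← Set.compl_inter] at h1
    have h2 := failure_probability_le hε hε1.le (d := k * H.card) hm0
      (Nat.le_mul_of_pos_right k (by omega)) (by rw [hHcard]; nlinarith) hRm
    rw [← hn] at h2
    linarith
  have hS := half_le_perturbationLaw_smoothingSucceeds G hρ hρn (by rw [hn]; nlinarith)
    (by rw [hn]; nlinarith) hG
  refine ⟨E₁ ∩ E₂, hE, ?_, ?_, fun g hg G' hG' => ?_⟩
  · have h1 := probReal_compl_eq_one_sub (μ := perturbationLaw n k ρ) hE
    have h2 : 0 ≤ (perturbationLaw n k ρ).real (E₁ ∩ E₂)ᶜ := measureReal_nonneg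
    linarith
  · have h1 := one_sub_le_cond_real hE hS
    linarith
  · have hsub : H₁ ⊆ H ∧ H₂ ⊆ H ∧ H₃ ⊆ H := by
      subst hHu
      exact ⟨fun x hx => by simp [hx], fun x hx => by simp [hx], fun x hx => by simp [hx]⟩
    have hmpos : (0 : ℝ) < m := by exact_mod_cast hm0
    -- at least a quarter of all rows avoid `H`
    have hα : ∀ v, ε * ρ * (3 * m) / 8 * ‖v‖ ≤ ‖rowMap (G.cov + perturbation g) Hᶜ H v‖ := by
      intro v
      refine le_trans (mul_le_mul_of_nonneg_right ?_ (norm_nonneg v)) (hE₁v g hg.1 v)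
      have h1 : 3 * (m : ℝ) / 2 ≤ √(Hᶜ.card : ℝ) := by
        refine Real.le_sqrt_of_sq_le ?_
        have h2 : 9 * m ^ 2 ≤ 4 * Hᶜ.card := by omega
        have h3 : 9 * (m : ℝ) ^ 2 ≤ 4 * Hᶜ.card := by exact_mod_cast h2
        linarith
      have h2 := mul_le_mul_of_nonneg_left h1 (mul_pos hε hρ).le
      linarith
    obtain ⟨hsv, hspan⟩ := hG'.singularValue_and_span hRH hsub.1 hsub.2.1 hsub.2.2 h₁₂ h₁₃ h₂₃ hω₀
      hω (by positivity) (by positivity) hα (hE₂v g hg.2) (Nat.mul_pos hk (by omega))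
    refine ⟨le_trans (le_of_eq ?_) hsv, hspan⟩
    rw [show (n : ℝ) = 9 * (m : ℝ) ^ 2 by exact_mod_cast hn]
    ring
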